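/- Let $q\ge 2$ be an integer, $\beta\ge 0$, $\theta=\tanh\beta$, and let $Q$ be a probability measure on $\{0,1,2,\dots\}$ with mean $Q(d_0)\in[0,\infty]$. Let $T$ be the random rooted tree in which the numbers of children of the vertices are i.i.d. with law $Q$ ($T$ may be finite). For a finite tree $S$, the free boundary condition $q$-state Potts measure on $\{1,\dots,q\}^{S}$ gives a configuration $\eta$ the probability $$\frac1{Z_{\beta,S}}\exp\Bigl(2\beta\sum_{(v,w)}\delta_{\eta(v),\eta(w)}\Bigr),$$ the sum being over the edges of $S$. The free boundary condition Potts measure $\mathbb P$ on $\{1,\dots,q\}^{T}$ is the weak limit, as $N\to\infty$, of the free boundary condition Potts measures on the subtrees $T^N$ of vertices at distance at most $N$ from the root. A Potts Gibbs measure on $T$ is a probability measure on $\{1,\dots,q\}^T$ under which, for every finite set $\Lambda$ of vertices, the conditional probability of $\eta_\Lambda$ given the spins $\bar\eta$ outside $\Lambda$ is $$\frac1{Z_{\beta,\Lambda}^{\bar\eta}}\exp\Bigl(2\beta\sum_{(v,w),\,v,w\in\Lambda}\delta_{\eta(v),\eta(w)}+2\beta\sum_{(v,w),\,v\in\Lambda,\,w\notin\Lambda}\delta_{\eta(v),\bar\eta(w)}\Bigr).$$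 It is extremal if it is not a nontrivial convex combination of Potts Gibbs measures, that is, if it is an extreme point of the set of Potts Gibbs measures on $T$. Let $P=\{p\in[0,\infty)^q:\sum_i p_i=1\}$ and $$\bar c(\beta,q)=\sup_{p\in P,\;p\ne(1/q,\dots,1/q)}\frac{\sum_{i=1}^q(qp_i-1)\log\bigl(1+(e^{2\beta}-1)p_i\bigr)}{\sum_{i=1}^q(qp_i-1)\log(qp_i)},$$ where the ratio is $0$ if some $p_i=0$ (the denominator is then $+\infty$). **Theorem.** If $$Q(d_0)\,\frac{2\theta}{q-(q-2)\theta}\,\bar c(\beta,q)<1$$ (with $\infty\cdot 0=0$), then for almost every tree $T$ the free boundary condition Potts measure $\mathbb P$ on $T$ exists and is an extremal Potts Gibbs measure. Moreover, for almost every $T$ there is no reconstruction: for all $i,j\in\{1,\dots,q\}$, the total variation distance between the laws under $\mathbb P$ of the spins at distance $N$ from the root, conditioned on the root spin being $i$ and being $j$ respectively, tends to $0$ as $N\to\infty$. -/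

import Mathlib

open MeasureTheory ProbabilityTheory Filter Topology
open scoped ENNReal NNReal

noncomputable section

/-! ### The Potts model on a graph -/

section Potts

open scoped Classical in
/-- The Kronecker delta `δ_{η(v), η(w)}` of the two end points of an edge `{v, w}`. -/
def edgeAgree {V : Type*} {q : ℕ} (η : V → Fin q) (e : Sym2 V) : ℝ :=
  Sym2.lift ⟨fun v w => if η v = η w then (1 : ℝ) else 0,
    fun v w => by simp only [eq_comm]⟩ e

open scoped Classical in
/-- The unnormalised free boundary condition Potts weight
`exp (2 β ∑_{(v,w)} δ_{σ(v),σ(w)})` on a finite graph, the sum being over all edges. -/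
def freeWeight {W : Type*} [Fintype W] (H : SimpleGraph W) {q : ℕ} (β : ℝ) (σ : W → Fin q) : ℝ :=
  Real.exp (2 * β * ∑ e ∈ H.edgeFinset, edgeAgree σ e)

open scoped Classical in
/-- The free boundary condition Potts probability of a configuration on a finite graph. -/
def freeProb {W : Type*} [Fintype W] (H : SimpleGraph W) {q : ℕ} (β : ℝ) (σ : W → Fin q) : ℝ :=
  freeWeight H β σ / ∑ τ : W → Fin q, freeWeight H β τ

open scoped Classical in
/-- The configuration equal to `σ` on the finite set `Λ` and to `η` off `Λ`. -/
def glue {V : Type*} {q : ℕ} (Λ : Finset V) (σ : Λ → Fin q) (η : V → Fin q) : V → Fin q :=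
  fun v => if h : v ∈ Λ then σ ⟨v, h⟩ else η v

open scoped Classical in
/-- The Boltzmann factor of `η` in the finite volume `Λ`: all edges with at least one end point
in `Λ` contribute. -/
def volumeWeight {V : Type*} (G : SimpleGraph V) [G.LocallyFinite] {q : ℕ} (β : ℝ) (Λ : Finset V)
    (η : V → Fin q) : ℝ :=
  Real.exp (2 * β * ∑ e ∈ Λ.biUnion fun v => G.incidenceFinset v, edgeAgree η e)

open scoped Classical in
/-- The Potts specification: the probability of `σ` in the finite volume `Λ` with boundary
condition `η` off `Λ`. -/
def pottsCond {V : Type*} (G : SimpleGraph V) [G.LocallyFinite] {q : ℕ} (β : ℝ) (Λ : Finset V)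
    (σ : Λ → Fin q) (η : V → Fin q) : ℝ :=
  volumeWeight G β Λ (glue Λ σ η) / ∑ τ : Λ → Fin q, volumeWeight G β Λ (glue Λ τ η)

/-- Potts Gibbs measures (DLR equations): for every finite `Λ` the conditional probabilities of
the configuration in `Λ`, given the spins outside `Λ`, are those of the Potts specification. -/
structure IsPottsGibbs {V : Type*} (G : SimpleGraph V) [G.LocallyFinite] {q : ℕ} (β : ℝ)
    (μ : Measure (V → Fin q)) : Prop where
  isProbabilityMeasure : IsProbabilityMeasure μ
  dlr : ∀ (Λ : Finset V) (σ : Λ → Fin q),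
    μ[Set.indicator {η : V → Fin q | ∀ v : Λ, η v = σ v} (fun _ => (1 : ℝ)) |
      cylinderEvents (X := fun _ : V => Fin q) ((Λ : Set V)ᶜ)]
      =ᵐ[μ] fun η => pottsCond G β Λ σ η

/-- A Gibbs measure is extremal if it is not a nontrivial convex combination of Gibbs measures,
i.e. if it is an extreme point of the convex set of Gibbs measures. -/
def IsExtremalPottsGibbs {V : Type*} (G : SimpleGraph V) [G.LocallyFinite] {q : ℕ} (β : ℝ)
    (μ : Measure (V → Fin q)) : Prop :=
  μ ∈ Set.extremePoints ℝ≥0 {ν : Measure (V → Fin q) | IsPottsGibbs G β ν}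

end Potts

/-! ### Rooted trees with prescribed offspring numbers -/

section Tree

/-- Vertices are words: the root is `[]`, and the children of `v` are `k :: v`, `k < d v`, where
`d v` is the number of children of `v`. `InTree d v` says that the word `v` occurs in the tree. -/
def InTree (d : List ℕ → ℕ) : List ℕ → Prop
  | [] => True
  | k :: v => InTree d v ∧ k < d v

/-- The vertex set of the tree with offspring numbers `d`. -/
abbrev TreeVertex (d : List ℕ → ℕ) : Type := {v : List ℕ // InTree d v}

/-- The root. -/
def treeRoot (d : List ℕ → ℕ) : TreeVertex d := ⟨[], trivial⟩

/-- The tree as a graph: its edges join each vertex to its children. -/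
def treeGraph (d : List ℕ → ℕ) : SimpleGraph (TreeVertex d) where
  Adj v w := (∃ k : ℕ, w.1 = k :: v.1) ∨ ∃ k : ℕ, v.1 = k :: w.1
  symm := ⟨fun _ _ h => h.symm⟩
  loopless := ⟨fun v h => by
    rcases h with ⟨k, h⟩ | ⟨k, h⟩ <;>
      · have := congrArg List.length h
        simp at this⟩

/-- The vertices at distance `N` from the root. -/
abbrev TreeLevel (d : List ℕ → ℕ) (N : ℕ) : Type := {v : TreeVertex d // v.1.length = N}

/-- The vertices at distance at most `N` from the root. -/
def treeBall (d : List ℕ → ℕ) (N : ℕ) : Set (TreeVertex d) := {v | v.1.length ≤ N}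

theorem finite_words (d : List ℕ → ℕ) (N : ℕ) :
    {v : List ℕ | InTree d v ∧ v.length = N}.Finite := by
  induction N with
  | zero =>
    refine (Set.finite_singleton []).subset ?_
    rintro v ⟨-, hv⟩
    simpa using hv
  | succ N ih =>
    refine (ih.biUnion fun v _ => (Set.finite_lt_nat (d v)).image fun k => k :: v).subset ?_
    rintro v ⟨hv, hN⟩
    cases v with
    | nil => simp at hN
    | cons k v =>
      simp only [Set.mem_iUnion]
      exact ⟨v, ⟨hv.1, by simpa using hN⟩, k, hv.2, rfl⟩

instance finite_treeLevel (d : List ℕ → ℕ) (N : ℕ) : Finite (TreeLevel d N) := by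
  have := (finite_words d N).to_subtype
  exact Finite.of_injective
    (fun v : TreeLevel d N => (⟨v.1.1, v.1.2, v.2⟩ : {v : List ℕ | InTree d v ∧ v.length = N}))
    fun v w h => Subtype.ext (Subtype.ext (congrArg (fun x => x.1) h))

instance finite_treeBall (d : List ℕ → ℕ) (N : ℕ) : Finite (treeBall d N) := by
  exact Finite.of_injective
    (fun v : treeBall d N =>
      (⟨⟨v.1.1.length, Nat.lt_succ_of_le v.2⟩, ⟨v.1, rfl⟩⟩ :
        Σ n : Fin (N + 1), TreeLevel d n))
    fun v w h => by
      have := congrArg (fun x : Σ n : Fin (N + 1), TreeLevel d n => x.2.1) h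
      exact Subtype.ext this

instance fintype_treeLevel (d : List ℕ → ℕ) (N : ℕ) : Fintype (TreeLevel d N) :=
  Fintype.ofFinite _

instance fintype_treeBall (d : List ℕ → ℕ) (N : ℕ) : Fintype (treeBall d N) :=
  Fintype.ofFinite _

instance locallyFinite_treeGraph (d : List ℕ → ℕ) : (treeGraph d).LocallyFinite := fun v =>
  have : Finite ((treeGraph d).neighborSet v) := by
    refine ((Set.toFinite (treeBall d (v.1.length + 1))).subset ?_).to_subtype
    rintro w (⟨k, h⟩ | ⟨k, h⟩)
    · exact (congrArg List.length h).le
    · have := congrArg List.length h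
      simp only [List.length_cons] at this
      show w.1.length ≤ v.1.length + 1
      omega
  Fintype.ofFinite _

open scoped Classical in
/-- `μ` is the free boundary condition Potts measure on the tree: the weak limit, i.e. the limit of
the probabilities of all events that fix finitely many spins, of the free boundary condition Potts
measures on the finite trees `T^N` cut off at depth `N`. -/
structure IsFreePotts (d : List ℕ → ℕ) {q : ℕ} (β : ℝ) (μ : Measure (TreeVertex d → Fin q)) :
    Prop where
  isProbabilityMeasure : IsProbabilityMeasure μ
  tendsto : ∀ (Δ : Finset (TreeVertex d)) (ζ : TreeVertex d → Fin q),
    Tendsto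
      (fun N : ℕ => ∑ σ : treeBall d N → Fin q with ∀ v : treeBall d N, v.1 ∈ Δ → σ v = ζ v.1,
        freeProb ((treeGraph d).induce (treeBall d N)) β σ)
      atTop (𝓝 (μ.real {η | ∀ v ∈ Δ, η v = ζ v}))

/-- Non-reconstruction: for any two spin values `i`, `j`, the total variation distance between the
laws of the spins at distance `N` from the root, given that the root spin is `i` respectively `j`,
tends to `0` as `N → ∞`. -/
def NonReconstruction (d : List ℕ → ℕ) {q : ℕ} (μ : Measure (TreeVertex d → Fin q)) : Prop :=
  ∀ i j : Fin q, Tendsto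
    (fun N : ℕ => (1 / 2 : ℝ) * ∑ ξ : TreeLevel d N → Fin q,
      |(cond μ {η | η (treeRoot d) = i}).real {η | ∀ v : TreeLevel d N, η v.1 = ξ v} -
        (cond μ {η | η (treeRoot d) = j}).real {η | ∀ v : TreeLevel d N, η v.1 = ξ v}|)
    atTop (𝓝 0)

end Tree

/-! ### The constant -/

section Constant

open scoped Classical in
/-- The ratio whose supremum is taken. If some `p i = 0`, the denominator is `+∞`, because of the
summand `(0 - 1) * log 0`, and the ratio is `0` (in Lean `Real.log 0 = 0`, so this case is listed
separately). -/
def pottsRatio (β : ℝ) (q : ℕ) (p : Fin q → ℝ) : ℝ :=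
  if ∀ i, 0 < p i then
    (∑ i, (q * p i - 1) * Real.log (1 + (Real.exp (2 * β) - 1) * p i)) /
      ∑ i, (q * p i - 1) * Real.log (q * p i)
  else 0

/-- The supremum of the ratio over the simplex of probability vectors, without the
equidistribution, where the ratio is `0 / 0`. -/
def cBar (β : ℝ) (q : ℕ) : ℝ :=
  sSup (pottsRatio β q '' {p ∈ stdSimplex ℝ (Fin q) | p ≠ fun _ => 1 / (q : ℝ)})

end Constant

end

noncomputable section

namespace PottsTree

/-! ### The entropy contraction of one edge -/

section Entropy

variable {q : ℕ} {β : ℝ}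

/-- The transition probability of the Potts chain along an edge. -/
def transition (β : ℝ) (i s : Fin q) : ℝ :=
  (if i = s then Real.exp (2 * β) else 1) / (Real.exp (2 * β) + q - 1)

/-- The action of the transition matrix on vectors. -/
def broadcast (β : ℝ) (f : Fin q → ℝ) (i : Fin q) : ℝ := ∑ s, transition β i s * f s

/-- The symmetrised relative entropy of `f` and the equidistribution, homogeneous of degree one. -/
def symmEntropy (f : Fin q → ℝ) : ℝ := ∑ a, (f a - (∑ b, f b) / q) * Real.log (f a)

/-- The factor by which the symmetrised entropy contracts along an edge. -/
def rate (β : ℝ) (q : ℕ) : ℝ :=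
  2 * Real.tanh β / (q - (q - 2) * Real.tanh β) * cBar β q

theorem normalizer_pos [NeZero q] (β : ℝ) : 0 < Real.exp (2 * β) + q - 1 := by
  have := Real.exp_pos (2 * β)
  have : (1 : ℝ) ≤ q := by exact_mod_cast NeZero.one_le
  linarith

theorem transition_pos [NeZero q] (i s : Fin q) : 0 < transition β i s := by
  unfold transition
  have := normalizer_pos (q := q) β
  split_ifs <;> positivity

theorem broadcast_apply (f : Fin q → ℝ) (i : Fin q) :
    broadcast β f i =
      (∑ s, f s + (Real.exp (2 * β) - 1) * f i) / (Real.exp (2 * β) + q - 1) := by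
  have h : ∀ s, transition β i s * f s =
      (f s + if i = s then (Real.exp (2 * β) - 1) * f s else 0) / (Real.exp (2 * β) + q - 1) := by
    intro s
    unfold transition
    split_ifs <;> ring
  simp only [broadcast, h]
  rw [← Finset.sum_div, Finset.sum_add_distrib]
  simp

theorem sum_transition [NeZero q] (i : Fin q) : ∑ s, transition β i s = 1 := by
  have h := broadcast_apply (β := β) (fun _ : Fin q => (1 : ℝ)) i
  have := normalizer_pos (q := q) β
  simp only [broadcast, mul_one] at h
  rw [h]
  simp only [Finset.sum_const, Finset.card_univ, Fintype.card_fin, nsmul_eq_mul, mul_one]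
  rw [div_eq_one_iff_eq this.ne']
  ring

theorem sum_broadcast [NeZero q] (f : Fin q → ℝ) : ∑ i, broadcast β f i = ∑ i, f i := by
  have := normalizer_pos (q := q) β
  simp only [broadcast_apply]
  rw [← Finset.sum_div, Finset.sum_add_distrib, ← Finset.mul_sum]
  simp only [Finset.sum_const, Finset.card_univ, Fintype.card_fin, nsmul_eq_mul]
  field_simp
  ring

theorem broadcast_pos [NeZero q] {f : Fin q → ℝ} (hf : ∀ i, 0 ≤ f i) (h : ∃ i, 0 < f i)
    (i : Fin q) : 0 < broadcast β f i := by
  obtain ⟨k, hk⟩ := h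
  exact Finset.sum_pos' (fun s _ => mul_nonneg (transition_pos i s).le (hf s))
    ⟨k, Finset.mem_univ k, mul_pos (transition_pos i k) hk⟩

theorem rate_eq (hq : 2 ≤ q) :
    rate β q = (Real.exp (2 * β) - 1) / (Real.exp (2 * β) + q - 1) * cBar β q := by
  have : NeZero q := ⟨by omega⟩
  have h1 := normalizer_pos (q := q) β
  have h2 : (0 : ℝ) < Real.exp (2 * β) + 1 := by positivity
  have h3 : Real.tanh β = (Real.exp (2 * β) - 1) / (Real.exp (2 * β) + 1) := by
    rw [Real.tanh_eq_sinh_div_cosh, Real.sinh_eq, Real.cosh_eq, Real.exp_neg,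
      show 2 * β = β + β by ring, Real.exp_add]
    have := Real.exp_pos β
    field_simp
  have h4 : (q : ℝ) - (q - 2) * Real.tanh β =
      2 * (Real.exp (2 * β) + q - 1) / (Real.exp (2 * β) + 1) := by
    rw [h3]; field_simp; ring
  rw [rate, h4, h3]
  congr 1
  field_simp

theorem sub_mul_log_nonneg {u : ℝ} (hu : 0 < u) : 0 ≤ (u - 1) * Real.log u := by
  rcases le_total 1 u with h | h
  · exact mul_nonneg (by linarith) (Real.log_nonneg h)
  · exact mul_nonneg_of_nonpos_of_nonpos (by linarith) (Real.log_nonpos hu.le h)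

theorem sub_mul_log_affine {u c : ℝ} (hu : 0 < u) (hc : 0 ≤ c) :
    0 ≤ (u - 1) * (Real.log (1 + c * u) - Real.log (1 + c)) ∧
      (u - 1) * (Real.log (1 + c * u) - Real.log (1 + c)) ≤ (u - 1) * Real.log u := by
  have h1 : 0 < 1 + c := by linarith
  have h2 : 0 < 1 + c * u := by positivity
  have h3 : Real.log u + Real.log (1 + c) = Real.log (u * (1 + c)) :=
    (Real.log_mul hu.ne' h1.ne').symm
  rcases le_total 1 u with h | h
  · have a1 : Real.log (1 + c) ≤ Real.log (1 + c * u) := Real.log_le_log h1 (by nlinarith)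
    have a2 : Real.log (1 + c * u) ≤ Real.log (u * (1 + c)) := Real.log_le_log h2 (by nlinarith)
    exact ⟨mul_nonneg (by linarith) (by linarith),
      mul_le_mul_of_nonneg_left (by linarith) (by linarith)⟩
  · have a1 : Real.log (1 + c * u) ≤ Real.log (1 + c) := Real.log_le_log h2 (by nlinarith)
    have a2 : Real.log (u * (1 + c)) ≤ Real.log (1 + c * u) :=
      Real.log_le_log (by positivity) (by nlinarith)
    exact ⟨mul_nonneg_of_nonpos_of_nonpos (by linarith) (by linarith),
      mul_le_mul_of_nonpos_left (by linarith) (by linarith)⟩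

theorem pottsRatio_num [NeZero q] {p : Fin q → ℝ} (hs : ∑ i, p i = 1) :
    ∑ i, (q * p i - 1) * Real.log (1 + (Real.exp (2 * β) - 1) * p i) =
      ∑ i, (q * p i - 1) * (Real.log (1 + (Real.exp (2 * β) - 1) / q * (q * p i)) -
        Real.log (1 + (Real.exp (2 * β) - 1) / q)) := by
  have hq : (q : ℝ) ≠ 0 := NeZero.ne _
  have h0 : ∑ i, (q * p i - 1) = 0 := by
    rw [Finset.sum_sub_distrib, ← Finset.mul_sum, hs]; simp
  simp only [mul_sub _ (Real.log _) _]
  rw [Finset.sum_sub_distrib, ← Finset.sum_mul, h0, zero_mul, sub_zero]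
  refine Finset.sum_congr rfl fun i _ => ?_
  rw [div_mul_eq_mul_div, ← mul_assoc, mul_div_right_comm, mul_div_assoc, mul_assoc]
  field_simp

theorem pottsRatio_nonneg [NeZero q] (hβ : 0 ≤ β) {p : Fin q → ℝ} (hp : p ∈ stdSimplex ℝ (Fin q)) :
    0 ≤ pottsRatio β q p := by
  have hq : (0 : ℝ) < q := by exact_mod_cast Nat.pos_of_neZero q
  have hx : 0 ≤ Real.exp (2 * β) - 1 := by
    have := Real.one_le_exp (x := 2 * β) (by linarith)
    linarith
  unfold pottsRatio
  split_ifs with h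
  · rw [pottsRatio_num hp.2]
    have hu : ∀ i, 0 < q * p i := fun i => mul_pos hq (h i)
    exact div_nonneg
      (Finset.sum_nonneg fun i _ => (sub_mul_log_affine (hu i) (by positivity)).1)
      (Finset.sum_nonneg fun i _ => sub_mul_log_nonneg (hu i))
  · exact le_rfl

theorem pottsRatio_le_one [NeZero q] (hβ : 0 ≤ β) {p : Fin q → ℝ} (hp : p ∈ stdSimplex ℝ (Fin q)) :
    pottsRatio β q p ≤ 1 := by
  have hq : (0 : ℝ) < q := by exact_mod_cast Nat.pos_of_neZero q
  have hx : 0 ≤ Real.exp (2 * β) - 1 := by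
    have := Real.one_le_exp (x := 2 * β) (by linarith)
    linarith
  unfold pottsRatio
  split_ifs with h
  · rw [pottsRatio_num hp.2]
    have hu : ∀ i, 0 < q * p i := fun i => mul_pos hq (h i)
    exact div_le_one_of_le₀
      (Finset.sum_le_sum fun i _ => (sub_mul_log_affine (hu i) (by positivity)).2)
      (Finset.sum_nonneg fun i _ => sub_mul_log_nonneg (hu i))
  · exact zero_le_one

theorem cBar_nonneg [NeZero q] (hβ : 0 ≤ β) : 0 ≤ cBar β q := by
  refine Real.sSup_nonneg ?_
  rintro _ ⟨p, hp, rfl⟩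
  exact pottsRatio_nonneg hβ hp.1

theorem rate_nonneg (hq : 2 ≤ q) (hβ : 0 ≤ β) : 0 ≤ rate β q := by
  have : NeZero q := ⟨by omega⟩
  have hx : 0 ≤ Real.exp (2 * β) - 1 := by
    have := Real.one_le_exp (x := 2 * β) (by linarith)
    linarith
  rw [rate_eq hq]
  exact mul_nonneg (div_nonneg hx (normalizer_pos β).le) (cBar_nonneg hβ)

theorem pottsRatio_le_cBar [NeZero q] (hβ : 0 ≤ β) {p : Fin q → ℝ}
    (hp : p ∈ stdSimplex ℝ (Fin q)) (hne : p ≠ fun _ => 1 / (q : ℝ)) :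
    pottsRatio β q p ≤ cBar β q := by
  refine le_csSup ⟨1, ?_⟩ ⟨p, ⟨hp, hne⟩, rfl⟩
  rintro _ ⟨p, hp, rfl⟩
  exact pottsRatio_le_one hβ hp.1

theorem sum_centered [NeZero q] (f : Fin q → ℝ) : ∑ a, (f a - (∑ b, f b) / q) = 0 := by
  have hq : (q : ℝ) ≠ 0 := NeZero.ne _
  rw [Finset.sum_sub_distrib]
  simp only [Finset.sum_const, Finset.card_univ, Fintype.card_fin, nsmul_eq_mul]
  field_simp
  ring

/-- The symmetrised entropy decreases at least by the factor `rate β q` along an edge. -/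
theorem symmEntropy_broadcast_le (hq : 2 ≤ q) (hβ : 0 ≤ β) {f : Fin q → ℝ} (hf : ∀ i, 0 < f i) :
    symmEntropy (broadcast β f) ≤ rate β q * symmEntropy f := by
  have : NeZero q := ⟨by omega⟩
  have hq0 : (0 : ℝ) < q := by exact_mod_cast Nat.pos_of_neZero q
  have hn := normalizer_pos (q := q) β
  have hx : 0 ≤ Real.exp (2 * β) - 1 := by
    have := Real.one_le_exp (x := 2 * β) (by linarith)
    linarith
  set s : ℝ := ∑ b, f b with hsdef
  set x : ℝ := Real.exp (2 * β)
  have hs : 0 < s := Finset.sum_pos (fun i _ => hf i) Finset.univ_nonempty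
  set p : Fin q → ℝ := fun i => f i / s with hpdef
  have hp0 : ∀ i, 0 < p i := fun i => div_pos (hf i) hs
  have hp1 : ∑ i, p i = 1 := by
    rw [hpdef, ← Finset.sum_div, div_self hs.ne']
  have hps : p ∈ stdSimplex ℝ (Fin q) := ⟨fun i => (hp0 i).le, hp1⟩
  have hfp : ∀ i, f i = s * p i := fun i => by rw [hpdef]; field_simp
  have hc := sum_centered f
  rw [← hsdef] at hc
  have e1 : symmEntropy f = s / q * ∑ i, (q * p i - 1) * Real.log (q * p i) := by
    have : ∀ i, s / q * ((q * p i - 1) * Real.log (q * p i)) =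
        (f i - s / q) * Real.log (f i) + (f i - s / q) * Real.log (q / s) := by
      intro i
      rw [show (q : ℝ) * p i = f i * (q / s) by rw [hpdef]; ring,
        Real.log_mul (hf i).ne' (by positivity)]
      field_simp
    rw [Finset.mul_sum, Finset.sum_congr rfl fun i _ => this i, Finset.sum_add_distrib,
      ← Finset.sum_mul, hc, zero_mul, add_zero]
    rfl
  have e2 : symmEntropy (broadcast β f) = (x - 1) / (x + q - 1) * (s / q) *
      ∑ i, (q * p i - 1) * Real.log (1 + (x - 1) * p i) := by
    have : ∀ i, (broadcast β f i - s / q) * Real.log (broadcast β f i) =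
        (x - 1) / (x + q - 1) * (s / q) * ((q * p i - 1) * Real.log (1 + (x - 1) * p i)) +
          (f i - s / q) * ((x - 1) / (x + q - 1) * Real.log (s / (x + q - 1))) := by
      intro i
      have hb : broadcast β f i = (1 + (x - 1) * p i) * (s / (x + q - 1)) := by
        rw [broadcast_apply, ← hsdef, hfp i]; ring
      have h1 : 0 < 1 + (x - 1) * p i := by have := mul_nonneg hx (hp0 i).le; linarith
      rw [hb, Real.log_mul h1.ne' (by positivity), hfp i]
      field_simp
      ring
    rw [symmEntropy, sum_broadcast, ← hsdef, Finset.sum_congr rfl fun i _ => this i,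
      Finset.sum_add_distrib, ← Finset.sum_mul, hc, zero_mul, add_zero, Finset.mul_sum]
  have hu : ∀ i, 0 < q * p i := fun i => mul_pos hq0 (hp0 i)
  have key : ∑ i, (q * p i - 1) * Real.log (1 + (x - 1) * p i) ≤
      cBar β q * ∑ i, (q * p i - 1) * Real.log (q * p i) := by
    by_cases hne : p = fun _ => 1 / (q : ℝ)
    · have : ∀ i, (q : ℝ) * p i - 1 = 0 := fun i => by rw [hne]; field_simp; ring
      simp [this]
    · have hden : 0 < ∑ i, (q * p i - 1) * Real.log (q * p i) := by
        obtain ⟨i, hi⟩ := Function.ne_iff.1 hne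
        refine Finset.sum_pos' (fun i _ => sub_mul_log_nonneg (hu i)) ⟨i, Finset.mem_univ i, ?_⟩
        refine (sub_mul_log_nonneg (hu i)).lt_of_ne' ?_
        have h1 : (q : ℝ) * p i ≠ 1 := fun h => hi (by rw [← h]; field_simp)
        refine mul_ne_zero (sub_ne_zero.2 h1) ?_
        exact Real.log_ne_zero_of_pos_of_ne_one (hu i) h1
      have h := pottsRatio_le_cBar hβ hps hne
      rw [pottsRatio, if_pos hp0, div_le_iff₀ hden] at h
      exact h
  rw [e1, e2, rate_eq hq]
  calc _ ≤ (x - 1) / (x + q - 1) * (s / q) *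
        (cBar β q * ∑ i, (q * p i - 1) * Real.log (q * p i)) :=
        mul_le_mul_of_nonneg_left key (by positivity)
    _ = _ := by ring

theorem sq_div_add_le {a b : ℝ} (ha : 0 < a) (hb : 0 < b) :
    (a - b) ^ 2 / (a + b) ≤ (a - b) * (Real.log a - Real.log b) := by
  wlog h : b ≤ a generalizing a b
  · have := this hb ha (le_of_not_ge h)
    rw [add_comm, show (a - b) ^ 2 = (b - a) ^ 2 by ring]
    linarith
  have h1 : 1 - (a / b)⁻¹ ≤ Real.log (a / b) := Real.one_sub_inv_le_log_of_pos (by positivity)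
  rw [Real.log_div ha.ne' hb.ne', inv_div] at h1
  have h2 : (a - b) / (a + b) ≤ 1 - b / a := by
    rw [one_sub_div ha.ne']
    exact div_le_div_of_nonneg_left (by linarith) ha (by linarith)
  calc (a - b) ^ 2 / (a + b) = (a - b) * ((a - b) / (a + b)) := by ring
    _ ≤ _ := mul_le_mul_of_nonneg_left (h2.trans h1) (by linarith)

theorem two_mul_symmEntropy [NeZero q] (f : Fin q → ℝ) :
    2 * q * symmEntropy f = ∑ a, ∑ b, (f a - f b) * (Real.log (f a) - Real.log (f b)) := by
  have hq : (q : ℝ) ≠ 0 := NeZero.ne _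
  simp only [sub_mul, mul_sub, Finset.sum_sub_distrib, Finset.sum_const, Finset.card_univ,
    Fintype.card_fin, nsmul_eq_mul, ← Finset.mul_sum, ← Finset.sum_mul, symmEntropy]
  field_simp
  ring

theorem sq_sub_div_add_le_symmEntropy [NeZero q] {f : Fin q → ℝ} (hf : ∀ i, 0 < f i)
    (i j : Fin q) : (f i - f j) ^ 2 / (f i + f j) ≤ 2 * q * symmEntropy f := by
  have h : ∀ a b, 0 ≤ (f a - f b) * (Real.log (f a) - Real.log (f b)) := fun a b =>
    le_trans (div_nonneg (sq_nonneg _) (add_pos (hf a) (hf b)).le) (sq_div_add_le (hf a) (hf b))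
  rw [two_mul_symmEntropy]
  refine (sq_div_add_le (hf i) (hf j)).trans ?_
  refine le_trans ?_ (Finset.single_le_sum
    (f := fun a => ∑ b, (f a - f b) * (Real.log (f a) - Real.log (f b)))
    (fun a _ => Finset.sum_nonneg fun b _ => h a b) (Finset.mem_univ i))
  exact Finset.single_le_sum (f := fun b => (f i - f b) * (Real.log (f i) - Real.log (f b)))
    (fun b _ => h i b) (Finset.mem_univ j)

end Entropy

/-! ### The Potts chain indexed by words -/

section Chain

variable {q : ℕ} [NeZero q] {β : ℝ}

/-- The law of the difference of the spins at the two ends of an edge. -/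
def stepLaw (β : ℝ) (q : ℕ) [NeZero q] : Measure (Fin q) :=
  ∑ s, ENNReal.ofReal (transition β 0 s) • Measure.dirac s

theorem stepLaw_singleton (s : Fin q) : stepLaw β q {s} = ENNReal.ofReal (transition β 0 s) := by
  simp [stepLaw, Set.indicator_apply]

instance : IsProbabilityMeasure (stepLaw β q) := by
  constructor
  simp only [stepLaw, Measure.coe_finsetSum, Measure.coe_smul, Finset.sum_apply, Pi.smul_apply,
    measure_univ, smul_eq_mul, mul_one]
  rw [← ENNReal.ofReal_sum_of_nonneg fun s _ => (transition_pos 0 s).le, sum_transition,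
    ENNReal.ofReal_one]

theorem transition_zero_sub (i s : Fin q) : transition β 0 (s - i) = transition β i s := by
  unfold transition
  congr 1
  refine if_congr ?_ rfl rfl
  rw [eq_comm, sub_eq_zero, eq_comm]

/-- Independent increments on all words. -/
def incrementLaw (β : ℝ) (q : ℕ) [NeZero q] : Measure (List ℕ → Fin q) :=
  Measure.infinitePi fun _ => stepLaw β q

instance : IsProbabilityMeasure (incrementLaw β q) := by
  unfold incrementLaw; infer_instance

/-- The spins with the given value at the root and the given increments along the edges. -/
def path (i : Fin q) (g : List ℕ → Fin q) : List ℕ → Fin q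
  | [] => i
  | k :: v => path i g v + g (k :: v)

/-- The restriction of a family indexed by words to the descendants of `[j]`. -/
def shift {α : Type*} (j : ℕ) (η : List ℕ → α) : List ℕ → α := fun w => η (w ++ [j])

theorem measurable_shift {α : Type*} [MeasurableSpace α] (j : ℕ) :
    Measurable (shift (α := α) j) := by
  unfold shift; fun_prop

theorem measurable_path_cylinderEvents (i : Fin q) :
    Measurable[cylinderEvents (X := fun _ : List ℕ => Fin q) {[]}ᶜ] (path i) := by
  refine @measurable_pi_lambda _ _ _ (cylinderEvents _) _ _ fun v => ?_
  induction v with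
  | nil => exact measurable_const
  | cons k v ih =>
    have h : Measurable[cylinderEvents (X := fun _ : List ℕ => Fin q) {[]}ᶜ]
        fun g : List ℕ → Fin q => g (k :: v) :=
      measurable_cylinderEvent_apply (by simp)
    exact @Measurable.add _ _ _ _ (cylinderEvents _) _ _ _ ih h

theorem measurable_path (i : Fin q) : Measurable (path (q := q) i) :=
  (measurable_path_cylinderEvents i).mono cylinderEvents_le_pi le_rfl

omit [NeZero q] in
theorem shift_path (i : Fin q) (j : ℕ) (g : List ℕ → Fin q) :
    shift j (path i g) = path (i + shift j g []) (shift j g) := by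
  funext w
  induction w with
  | nil => rfl
  | cons k v ih =>
    show path i g (v ++ [j]) + g (k :: v ++ [j]) = path _ _ v + g (k :: v ++ [j])
    rw [← ih]; rfl

/-- The law of the Potts chain with spin `i` at the root. -/
def chainLaw (β : ℝ) (i : Fin q) : Measure (List ℕ → Fin q) := (incrementLaw β q).map (path i)

instance (i : Fin q) : IsProbabilityMeasure (chainLaw β i) :=
  Measure.isProbabilityMeasure_map (measurable_path i).aemeasurable

theorem chainLaw_root (i : Fin q) : ∀ᵐ η ∂chainLaw β i, η [] = i := by
  rw [chainLaw, ae_map_iff (measurable_path i).aemeasurable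
    (measurableSet_eq_fun (by fun_prop) (by fun_prop))]
  exact Eventually.of_forall fun g => rfl

/-- Coordinates of a product measure in disjoint sets of indices are independent. -/
theorem indep_cylinderEvents {ι : Type*} {X : ι → Type*} [∀ i, MeasurableSpace (X i)]
    (P : ∀ i, Measure (X i)) [∀ i, IsProbabilityMeasure (P i)] {S T : Set ι} (h : Disjoint S T) :
    Indep (cylinderEvents S) (cylinderEvents T) (Measure.infinitePi P) :=
  indep_iSup_of_disjoint (fun i => (measurable_pi_apply i).comap_le)
    (iIndepFun_infinitePi (X := fun _ ω => ω) (fun _ => measurable_id)) h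

/-- The families of increments below the children of the root are independent copies. -/
theorem incrementLaw_map_shift :
    (incrementLaw β q).map (fun g j => shift j g) =
      Measure.infinitePi fun _ : ℕ => incrementLaw β q := by
  have hinj : Function.Injective fun p : ℕ × List ℕ => p.2 ++ [p.1] := by
    rintro ⟨j, v⟩ ⟨k, w⟩ h
    simpa [and_comm] using h
  have h1 := Measure.map_infinitePi_infinitePi_of_inj
    (P := fun _ : List ℕ => stepLaw β q) hinj
  have h2 := Measure.infinitePi_map_curry (ι := ℕ) (κ := List ℕ)
    (fun (_ : ℕ) (_ : List ℕ) => stepLaw β q)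
  unfold incrementLaw
  rw [← h2, ← h1, Measure.map_map (by fun_prop) (by fun_prop)]
  rfl

theorem incrementLaw_root_path (s i : Fin q) {E : Set (List ℕ → Fin q)} (hE : MeasurableSet E) :
    (incrementLaw β q).real {g | i + g [] = s ∧ path s g ∈ E} =
      transition β i s * (chainLaw β s).real E := by
  have hind := indep_cylinderEvents (fun _ : List ℕ => stepLaw β q)
    (S := {[]}) (T := {[]}ᶜ) disjoint_compl_right
  rw [Indep_iff] at hind
  have hA : MeasurableSet[cylinderEvents (X := fun _ : List ℕ => Fin q) {[]}]
      {g : List ℕ → Fin q | g [] = s - i} := by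
    have : Measurable[cylinderEvents (X := fun _ : List ℕ => Fin q) {[]}]
      fun g : List ℕ → Fin q => g [] := measurable_cylinderEvent_apply (by simp)
    exact this (measurableSet_singleton _)
  have hB := measurable_path_cylinderEvents s hE
  have h := hind _ _ hA hB
  have hset : {g : List ℕ → Fin q | i + g [] = s ∧ path s g ∈ E} =
      {g | g [] = s - i} ∩ path s ⁻¹' E := by
    ext g
    simp only [Set.mem_ofPred_eq, Set.mem_inter_iff, Set.mem_preimage]
    rw [eq_sub_iff_add_eq, add_comm]
  have h1 : Measure.infinitePi (fun _ : List ℕ => stepLaw β q) {g | g [] = s - i} =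
      ENNReal.ofReal (transition β i s) := by
    have he := (measurePreserving_eval_infinitePi (fun _ : List ℕ => stepLaw β q)
      []).measure_preimage (measurableSet_singleton (s - i)).nullMeasurableSet
    rw [stepLaw_singleton, transition_zero_sub] at he
    exact he
  rw [Measure.real, hset, incrementLaw, h, ENNReal.toReal_mul, h1,
    ENNReal.toReal_ofReal (transition_pos i s).le, chainLaw, Measure.real,
    Measure.map_apply (measurable_path s) hE]
  rfl

theorem incrementLaw_path_add_root (i : Fin q) {E : Set (List ℕ → Fin q)} (hE : MeasurableSet E) :
    (incrementLaw β q).real {g | path (i + g []) g ∈ E} =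
      broadcast β (fun s => (chainLaw β s).real E) i := by
  simp only [broadcast, ← incrementLaw_root_path _ i hE]
  rw [← measureReal_biUnion_finset]
  · congr 1
    ext g
    simp
  · intro s _ t _ hst
    refine Set.disjoint_left.2 fun g hg hg' => hst ?_
    exact hg.1.symm.trans hg'.1
  · intro s _
    exact (measurableSet_eq_fun (by fun_prop) (by fun_prop)).inter (measurable_path s hE)

theorem measurableSet_path_add_root (i : Fin q) {E : Set (List ℕ → Fin q)}
    (hE : MeasurableSet E) : MeasurableSet {g | path (i + g []) g ∈ E} := by
  have : {g | path (i + g []) g ∈ E} = ⋃ s, {g | i + g [] = s} ∩ path s ⁻¹' E := by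
    ext g; simp
  rw [this]
  exact MeasurableSet.iUnion fun s =>
    (measurableSet_eq_fun (by fun_prop) (by fun_prop)).inter (measurable_path s hE)

/-- Given the root spin, the spins below the children of the root are independent copies of the
chain, started after one step. -/
theorem chainLaw_branch (i : Fin q) (D : ℕ) {E : Fin D → Set (List ℕ → Fin q)}
    (hE : ∀ j, MeasurableSet (E j)) :
    (chainLaw β i).real {η | ∀ j : Fin D, shift j η ∈ E j} =
      ∏ j, broadcast β (fun s => (chainLaw β s).real (E j)) i := by
  classical
  let A : ℕ → Set (List ℕ → Fin q) := fun j =>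
    if h : j < D then {g | path (i + g []) g ∈ E ⟨j, h⟩} else Set.univ
  have hA : ∀ j, MeasurableSet (A j) := by
    intro j
    by_cases h : j < D
    · simpa only [A, h, dite_true] using measurableSet_path_add_root i (hE ⟨j, h⟩)
    · simp only [A, h, dite_false, MeasurableSet.univ]
  have hm : MeasurableSet {η : List ℕ → Fin q | ∀ j : Fin D, shift j η ∈ E j} := by
    rw [Set.ofPred_forall]
    exact MeasurableSet.iInter fun j => measurable_shift _ (hE j)
  have hset : path i ⁻¹' {η : List ℕ → Fin q | ∀ j : Fin D, shift j η ∈ E j} =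
      (fun g j => shift j g) ⁻¹' (Set.pi (Finset.range D : Set ℕ) A) := by
    ext g
    simp only [Set.mem_preimage, Set.mem_ofPred_eq, shift_path, Set.mem_pi, Finset.coe_range,
      Set.mem_Iio, A]
    constructor
    · intro h j hj
      rw [dif_pos hj]
      exact h ⟨j, hj⟩
    · intro h j
      have := h j j.2
      rw [dif_pos j.2] at this
      exact this
  rw [Measure.real, chainLaw, Measure.map_apply (measurable_path i) hm, hset,
    ← Measure.map_apply (measurable_pi_iff.2 fun j => measurable_shift j)
      (MeasurableSet.pi (Finset.countable_toSet _) fun j _ => hA j),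
    incrementLaw_map_shift, Measure.infinitePi_pi _ fun j _ => hA j, ENNReal.toReal_prod,
    Finset.prod_range]
  refine Finset.prod_congr rfl fun j _ => ?_
  rw [← incrementLaw_path_add_root i (hE j), Measure.real]
  simp only [A, j.2, dite_true]

theorem path_eq_iff {B : Finset (List ℕ)} (hB : ∀ k v, k :: v ∈ B → v ∈ B) (h0 : [] ∈ B)
    (i : Fin q) (g τ : List ℕ → Fin q) :
    (∀ v ∈ B, path i g v = τ v) ↔ i = τ [] ∧ ∀ v ∈ B.erase [], g v = τ v - τ v.tail := by
  constructor
  · refine fun h => ⟨h [] h0, fun v hv => ?_⟩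
    rw [Finset.mem_erase] at hv
    cases v with
    | nil => exact absurd rfl hv.1
    | cons k v =>
      rw [List.tail_cons, ← h _ hv.2, ← h _ (hB k v hv.2), path, add_sub_cancel_left]
  · rintro ⟨h, hg⟩ v
    induction v with
    | nil => exact fun _ => h
    | cons k v ih =>
      intro hv
      rw [path, ih (hB k v hv), hg _ (Finset.mem_erase.2 ⟨by simp, hv⟩), List.tail_cons,
        add_sub_cancel]

theorem measurableSet_agree {ι α : Type*} [MeasurableSpace α] [MeasurableSingletonClass α]
    (B : Finset ι) (τ : ι → α) :
    MeasurableSet {η : ι → α | ∀ v ∈ B, η v = τ v} := by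
  have : {η : ι → α | ∀ v ∈ B, η v = τ v} = ⋂ v ∈ B, (fun η => η v) ⁻¹' {τ v} := by
    ext; simp
  rw [this]
  exact Finset.measurableSet_biInter _ fun v _ => measurable_pi_apply v (measurableSet_singleton _)

/-- The law of the chain on a finite set of words that is closed under taking parents. -/
theorem chainLaw_agree {B : Finset (List ℕ)} (hB : ∀ k v, k :: v ∈ B → v ∈ B) (h0 : [] ∈ B)
    (i : Fin q) (τ : List ℕ → Fin q) :
    (chainLaw β i).real {η | ∀ v ∈ B, η v = τ v} =
      if i = τ [] then ∏ v ∈ B.erase [], transition β (τ v.tail) (τ v) else 0 := by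
  rw [Measure.real, chainLaw, Measure.map_apply (measurable_path i) (measurableSet_agree B τ)]
  simp only [Set.preimage_ofPred_eq, path_eq_iff hB h0]
  split_ifs with h
  · have hset : {g : List ℕ → Fin q | i = τ [] ∧ ∀ v ∈ B.erase [], g v = τ v - τ v.tail} =
        Set.pi (B.erase [] : Finset (List ℕ)) fun v => {τ v - τ v.tail} := by
      ext g
      simp only [h, true_and, Set.mem_ofPred_eq, Set.mem_pi, Finset.mem_coe,
        Set.mem_singleton_iff]
    rw [hset, incrementLaw, Measure.infinitePi_pi _ fun _ _ => measurableSet_singleton _,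
      ENNReal.toReal_prod]
    refine Finset.prod_congr rfl fun v _ => ?_
    rw [stepLaw_singleton, transition_zero_sub, ENNReal.toReal_ofReal (transition_pos _ _).le]
  · simp [h]

end Chain

/-! ### Sums of products over product types -/

section Products

variable {D : ℕ} {X : Fin D → Type*} [∀ j, Fintype (X j)]

theorem sum_pi_prod (c : ∀ j, X j → ℝ) : ∑ x : ∀ j, X j, ∏ j, c j (x j) = ∏ j, ∑ y, c j y := by
  classical
  rw [Finset.prod_univ_sum, Fintype.piFinset_univ]

theorem sum_pi_prod_mul (c F : ∀ j, X j → ℝ) (hc : ∀ j, ∑ y, c j y = 1) (j : Fin D) :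
    ∑ x : ∀ j, X j, (∏ k, c k (x k)) * F j (x j) = ∑ y, c j y * F j y := by
  have h : ∀ x : ∀ j, X j, (∏ k, c k (x k)) * F j (x j) =
      ∏ k, c k (x k) * (if k = j then F k (x k) else 1) := by
    intro x
    rw [Finset.prod_mul_distrib, Finset.prod_ite_eq' _ _ fun k => F k (x k)]
    simp
  simp only [h]
  rw [sum_pi_prod fun k y => c k y * (if k = j then F k y else 1),
    Finset.prod_eq_single j]
  · simp
  · intro k _ hk
    simp [hk, hc]
  · simp

/-- The `ℓ¹` distance of product weights is at most the sum of the distances of the factors. -/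
theorem sum_abs_prod_sub_prod_le (a b : ∀ j, X j → ℝ) (ha : ∀ j y, 0 ≤ a j y)
    (hb : ∀ j y, 0 ≤ b j y) (ha1 : ∀ j, ∑ y, a j y ≤ 1) (hb1 : ∀ j, ∑ y, b j y ≤ 1) :
    ∑ x : ∀ j, X j, |∏ j, a j (x j) - ∏ j, b j (x j)| ≤ ∑ j, ∑ y, |a j y - b j y| := by
  let c : Fin D → ∀ j, X j → ℝ := fun i j y =>
    if j < i then b j y else if i < j then a j y else |a j y - b j y|
  have hc0 : ∀ i j y, 0 ≤ c i j y := by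
    intro i j y
    simp only [c]
    split_ifs
    exacts [hb j y, ha j y, abs_nonneg _]
  have h : ∀ x : ∀ j, X j, |∏ j, a j (x j) - ∏ j, b j (x j)| ≤ ∑ i, ∏ j, c i j (x j) := by
    intro x
    have h1 := Finset.prod_sub_ordered Finset.univ (fun j => a j (x j))
      (fun j => a j (x j) - b j (x j))
    simp only [sub_sub_cancel] at h1
    rw [h1, sub_sub_cancel]
    refine (Finset.abs_sum_le_sum_abs _ _).trans (Finset.sum_le_sum fun i _ => le_of_eq ?_)
    rw [abs_mul, abs_mul, Finset.abs_prod, Finset.abs_prod,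
      Finset.prod_filter, Finset.prod_filter, mul_assoc, ← Finset.prod_mul_distrib,
      ← Finset.mul_prod_erase Finset.univ (fun j => c i j (x j)) (Finset.mem_univ i)]
    congr 1
    · simp [c]
    · rw [← Finset.mul_prod_erase Finset.univ _ (Finset.mem_univ i)]
      simp only [lt_irrefl, if_false, one_mul]
      refine Finset.prod_congr rfl fun j hj => ?_
      rcases lt_or_gt_of_ne (Finset.ne_of_mem_erase hj) with hlt | hlt
      · simp [c, hlt, hlt.not_gt, abs_of_nonneg (hb j (x j))]
      · simp [c, hlt, hlt.not_gt, abs_of_nonneg (ha j (x j))]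
  refine (Finset.sum_le_sum fun x _ => h x).trans ?_
  rw [Finset.sum_comm]
  refine Finset.sum_le_sum fun i _ => ?_
  rw [sum_pi_prod, ← Finset.mul_prod_erase Finset.univ _ (Finset.mem_univ i)]
  have h2 : ∏ j ∈ Finset.univ.erase i, ∑ y, c i j y ≤ 1 := by
    refine Finset.prod_le_one (fun j _ => Finset.sum_nonneg fun y _ => hc0 i j y) fun j hj => ?_
    rcases lt_or_gt_of_ne (Finset.ne_of_mem_erase hj) with hlt | hlt
    · simpa [c, hlt, hlt.not_gt] using hb1 j
    · simpa [c, hlt, hlt.not_gt] using ha1 j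
  have h3 : ∑ y, c i i y = ∑ y, |a i y - b i y| := by simp [c]
  rw [h3]
  exact mul_le_of_le_one_right (Finset.sum_nonneg fun _ _ => abs_nonneg _) h2

/-- Additivity of the symmetrised entropy over independent observations. -/
theorem sum_symmEntropy_prod {q : ℕ} (f : ∀ j, X j → Fin q → ℝ) (hf : ∀ j y a, 0 < f j y a)
    (hf1 : ∀ j a, ∑ y, f j y a = 1) :
    ∑ x : ∀ j, X j, symmEntropy (fun a => ∏ j, f j (x j) a) = ∑ j, ∑ y, symmEntropy (f j y) := by
  have h : ∀ x : ∀ j, X j, symmEntropy (fun a => ∏ j, f j (x j) a) =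
      ∑ j, ∑ a, ((∏ k, f k (x k) a) * Real.log (f j (x j) a) -
        (∑ b, (∏ k, f k (x k) b) * Real.log (f j (x j) a)) / q) := by
    intro x
    rw [symmEntropy, Finset.sum_comm]
    refine Finset.sum_congr rfl fun a _ => ?_
    rw [Real.log_prod fun j _ => (hf j (x j) a).ne', Finset.mul_sum]
    refine Finset.sum_congr rfl fun j _ => ?_
    rw [← Finset.sum_mul]
    ring
  simp only [h]
  rw [Finset.sum_comm]
  refine Finset.sum_congr rfl fun j _ => ?_
  rw [Finset.sum_comm]
  simp only [symmEntropy]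
  rw [Finset.sum_comm (s := (Finset.univ : Finset (X j)))]
  refine Finset.sum_congr rfl fun a _ => ?_
  rw [Finset.sum_sub_distrib, ← Finset.sum_div, Finset.sum_comm,
    sum_pi_prod_mul (fun k y => f k y a) (fun k y => Real.log (f k y a)) (fun k => hf1 k a) j]
  simp only [fun b => sum_pi_prod_mul (fun k y => f k y b) (fun k y => Real.log (f k y a))
    (fun k => hf1 k b) j]
  simp only [sub_mul, div_mul_eq_mul_div, Finset.sum_mul]
  rw [Finset.sum_sub_distrib, ← Finset.sum_div, Finset.sum_comm]

end Products

/-! ### Decomposition of the tree at the root -/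

section Levels

theorem inTree_append (d : List ℕ → ℕ) (j : ℕ) (w : List ℕ) :
    InTree d (w ++ [j]) ↔ j < d [] ∧ InTree (shift j d) w := by
  induction w with
  | nil => simp [InTree]
  | cons k w ih =>
    show InTree d (w ++ [j]) ∧ k < d (w ++ [j]) ↔ _ ∧ InTree (shift j d) w ∧ k < d (w ++ [j])
    rw [ih, and_assoc]

/-- A vertex at level `N` below the child `j` of the root, as a vertex of the tree. -/
def childLevel (d : List ℕ → ℕ) (N : ℕ) (p : Σ j : Fin (d []), TreeLevel (shift j d) N) :
    TreeLevel d (N + 1) :=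
  ⟨⟨p.2.1.1 ++ [p.1.1], (inTree_append _ _ _).2 ⟨p.1.2, p.2.1.2⟩⟩, by simp [p.2.2]⟩

theorem childLevel_bijective (d : List ℕ → ℕ) (N : ℕ) : Function.Bijective (childLevel d N) := by
  constructor
  · rintro ⟨⟨j, hj⟩, ⟨⟨v, hv⟩, hv'⟩⟩ ⟨⟨k, hk⟩, ⟨⟨w, hw⟩, hw'⟩⟩ h
    have h1 : v ++ [j] = w ++ [k] := congrArg (fun x : TreeLevel d (N + 1) => x.1.1) h
    obtain ⟨rfl, h2⟩ := List.append_inj' h1 rfl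
    obtain rfl : j = k := by simpa using h2
    rfl
  · rintro ⟨⟨v, hv⟩, hN⟩
    obtain ⟨w, j, rfl⟩ : ∃ w j, v = w ++ [j] :=
      List.eq_nil_or_concat' v |>.resolve_left (by rintro rfl; simp at hN)
    have h := (inTree_append _ _ _).1 hv
    exact ⟨⟨⟨j, h.1⟩, ⟨⟨w, h.2⟩, by simpa using hN⟩⟩, rfl⟩

/-- Vertices at level `N + 1` are vertices at level `N` below a child of the root. -/
def levelEquiv (d : List ℕ → ℕ) (N : ℕ) :
    (Σ j : Fin (d []), TreeLevel (shift j d) N) ≃ TreeLevel d (N + 1) :=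
  Equiv.ofBijective _ (childLevel_bijective d N)

/-- Splitting the spins at level `N + 1` according to the children of the root. -/
def splitLevel (d : List ℕ → ℕ) (N : ℕ) (α : Type*) :
    (TreeLevel d (N + 1) → α) ≃ ∀ j : Fin (d []), TreeLevel (shift j d) N → α :=
  ((levelEquiv d N).symm.arrowCongr (Equiv.refl α)).trans (Equiv.piCurry fun _ _ => α)

/-- The number of vertices at level `N`. -/
def levelSize (d : List ℕ → ℕ) (N : ℕ) : ℕ := Fintype.card (TreeLevel d N)

theorem levelSize_succ (d : List ℕ → ℕ) (N : ℕ) :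
    levelSize d (N + 1) = ∑ j : Fin (d []), levelSize (shift j d) N := by
  rw [levelSize, ← Fintype.card_congr (levelEquiv d N), Fintype.card_sigma]
  rfl

instance uniqueTreeLevelZero (d : List ℕ → ℕ) : Unique (TreeLevel d 0) where
  default := ⟨treeRoot d, rfl⟩
  uniq v := Subtype.ext (Subtype.ext (List.length_eq_zero_iff.1 v.2))

end Levels

/-! ### Posterior weights of the root spin -/

section Messages

variable {q : ℕ} {β : ℝ}

/-- The event that the spins at level `N` are `ξ`. -/
def levelEvent (d : List ℕ → ℕ) (N : ℕ) (ξ : TreeLevel d N → Fin q) : Set (List ℕ → Fin q) :=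
  {η | ∀ v : TreeLevel d N, η v.1.1 = ξ v}

/-- The event that the spins at the levels up to `n` are those of `τ`. -/
def ballEvent (d : List ℕ → ℕ) (n : ℕ) (τ : List ℕ → Fin q) : Set (List ℕ → Fin q) :=
  {η | ∀ v : List ℕ, InTree d v → v.length ≤ n → η v = τ v}

theorem measurableSet_levelEvent (d : List ℕ → ℕ) (N : ℕ) (ξ : TreeLevel d N → Fin q) :
    MeasurableSet (levelEvent d N ξ) := by
  rw [levelEvent, Set.ofPred_forall]
  exact MeasurableSet.iInter fun v => measurable_pi_apply v.1.1 (measurableSet_singleton _)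

theorem measurableSet_ballEvent (d : List ℕ → ℕ) (n : ℕ) (τ : List ℕ → Fin q) :
    MeasurableSet (ballEvent d n τ) := by
  simp only [ballEvent, Set.ofPred_forall]
  exact MeasurableSet.iInter fun v => MeasurableSet.iInter fun _ => MeasurableSet.iInter fun _ =>
    measurable_pi_apply v (measurableSet_singleton _)

theorem levelEvent_succ (d : List ℕ → ℕ) (N : ℕ) (ξ : TreeLevel d (N + 1) → Fin q) :
    levelEvent d (N + 1) ξ =
      {η | ∀ j : Fin (d []), shift j η ∈ levelEvent (shift j d) N (splitLevel d N _ ξ j)} := by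
  ext η
  constructor
  · exact fun h j v => h (childLevel d N ⟨j, v⟩)
  · intro h v
    obtain ⟨⟨j, v⟩, rfl⟩ := (childLevel_bijective d N).2 v
    exact h j v

theorem ballEvent_zero (d : List ℕ → ℕ) (τ : List ℕ → Fin q) :
    ballEvent d 0 τ = {η | η [] = τ []} := by
  ext η
  constructor
  · exact fun h => h [] trivial le_rfl
  · intro h v _ hv
    obtain rfl := List.length_eq_zero_iff.1 (Nat.le_zero.1 hv)
    exact h

theorem ballEvent_succ (d : List ℕ → ℕ) (n : ℕ) (τ : List ℕ → Fin q) :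
    ballEvent d (n + 1) τ = {η | η [] = τ []} ∩
      {η | ∀ j : Fin (d []), shift j η ∈ ballEvent (shift j d) n (shift j τ)} := by
  ext η
  constructor
  · exact fun h => ⟨h [] trivial (Nat.zero_le _), fun j v hv hn =>
      h (v ++ [j.1]) ((inTree_append _ _ _).2 ⟨j.2, hv⟩) (by simpa using hn)⟩
  · rintro ⟨h0, h⟩ v hv hn
    rcases List.eq_nil_or_concat' v with rfl | ⟨w, j, rfl⟩
    · exact h0
    · have hw := (inTree_append _ _ _).1 hv
      exact h ⟨j, hw.1⟩ w hw.2 (by simpa using hn)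

variable [NeZero q]

/-- The probability of `ξ` at level `N` as a function of the root spin. -/
def message (β : ℝ) (d : List ℕ → ℕ) (N : ℕ) (ξ : TreeLevel d N → Fin q) (i : Fin q) : ℝ :=
  (chainLaw β i).real (levelEvent d N ξ)

theorem message_nonneg (d : List ℕ → ℕ) (N : ℕ) (ξ : TreeLevel d N → Fin q) (i : Fin q) :
    0 ≤ message β d N ξ i := measureReal_nonneg

omit [NeZero q] in
theorem sum_real_inter_levelEvent (μ : Measure (List ℕ → Fin q)) [IsFiniteMeasure μ]
    (A : Set (List ℕ → Fin q)) (hA : MeasurableSet A) (d : List ℕ → ℕ) (N : ℕ) :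
    ∑ ξ, μ.real (A ∩ levelEvent d N ξ) = μ.real A := by
  rw [← measureReal_biUnion_finset]
  · congr 1
    ext η
    simp only [Finset.mem_univ, Set.iUnion_true, Set.mem_iUnion, Set.mem_inter_iff,
      exists_and_left, and_iff_left_iff_imp]
    exact fun _ => ⟨fun v => η v.1.1, fun v => rfl⟩
  · intro ξ _ ζ _ hne
    refine Set.disjoint_left.2 fun η h h' => hne ?_
    funext v
    exact (h.2 v).symm.trans (h'.2 v)
  · exact fun ξ _ => hA.inter (measurableSet_levelEvent d N ξ)

theorem sum_message (d : List ℕ → ℕ) (N : ℕ) (i : Fin q) : ∑ ξ, message β d N ξ i = 1 := by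
  have := sum_real_inter_levelEvent (chainLaw β i) Set.univ MeasurableSet.univ d N
  simp only [Set.univ_inter, probReal_univ] at this
  exact this

theorem message_zero (d : List ℕ → ℕ) (ξ : TreeLevel d 0 → Fin q) :
    message β d 0 ξ = Pi.single (ξ default) 1 := by
  funext i
  have h : levelEvent d 0 ξ =ᵐ[chainLaw β i] {_η | i = ξ default} := by
    filter_upwards [chainLaw_root (β := β) i] with η hη
    refine propext ⟨fun h => ?_, fun h v => ?_⟩
    · exact hη.symm.trans (h default)
    · rw [Subsingleton.elim v default]
      exact hη.trans h
  rw [message, measureReal_congr h, Pi.single_apply]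
  split_ifs with hi <;> simp [hi]

theorem message_succ (d : List ℕ → ℕ) (N : ℕ) (ξ : TreeLevel d (N + 1) → Fin q) (i : Fin q) :
    message β d (N + 1) ξ i =
      ∏ j : Fin (d []), broadcast β (message β (shift j d) N (splitLevel d N _ ξ j)) i := by
  rw [message, levelEvent_succ, chainLaw_branch i (d [])
    fun j => measurableSet_levelEvent (shift j d) N (splitLevel d N _ ξ j)]
  rfl

theorem exists_message_pos (d : List ℕ → ℕ) (N : ℕ) (ξ : TreeLevel d N → Fin q) :
    ∃ i, 0 < message β d N ξ i := by
  induction N generalizing d with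
  | zero => exact ⟨ξ default, by simp [message_zero]⟩
  | succ N ih =>
    refine ⟨0, ?_⟩
    rw [message_succ]
    exact Finset.prod_pos fun j _ => broadcast_pos (message_nonneg _ _ _) (ih _ _) _

theorem broadcast_message_pos (d : List ℕ → ℕ) (N : ℕ) (ξ : TreeLevel d N → Fin q) (i : Fin q) :
    0 < broadcast β (message β d N ξ) i :=
  broadcast_pos (message_nonneg _ _ _) (exists_message_pos _ _ _) _

theorem message_succ_pos (d : List ℕ → ℕ) (N : ℕ) (ξ : TreeLevel d (N + 1) → Fin q) (i : Fin q) :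
    0 < message β d (N + 1) ξ i := by
  rw [message_succ]
  exact Finset.prod_pos fun j _ => broadcast_message_pos _ _ _ _

omit [NeZero q] in
theorem sum_broadcast_comm {ι : Type*} [Fintype ι] (f : ι → Fin q → ℝ) (i : Fin q) :
    ∑ y, broadcast β (f y) i = broadcast β (fun s => ∑ y, f y s) i := by
  simp only [broadcast, Finset.mul_sum]
  exact Finset.sum_comm

theorem broadcast_const (c : ℝ) (i : Fin q) : broadcast β (fun _ => c) i = c := by
  rw [broadcast, ← Finset.sum_mul, sum_transition, one_mul]

theorem sum_broadcast_message (d : List ℕ → ℕ) (N : ℕ) (i : Fin q) :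
    ∑ ξ, broadcast β (message β d N ξ) i = 1 := by
  rw [sum_broadcast_comm]
  simp only [sum_message]
  exact broadcast_const 1 i

/-- The mean symmetrised entropy of the posterior weights given level `N`, up to normalisation. -/
def levelEntropy (β : ℝ) (q : ℕ) [NeZero q] (d : List ℕ → ℕ) (N : ℕ) : ℝ :=
  ∑ ξ : TreeLevel d N → Fin q, symmEntropy (message β d N ξ)

theorem levelEntropy_succ (d : List ℕ → ℕ) (N : ℕ) :
    levelEntropy β q d (N + 1) = ∑ j : Fin (d []),
      ∑ ξ : TreeLevel (shift j d) N → Fin q,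
        symmEntropy (broadcast β (message β (shift j d) N ξ)) := by
  rw [← sum_symmEntropy_prod (X := fun j : Fin (d []) => TreeLevel (shift j d) N → Fin q)
    (fun j ξ => broadcast β (message β (shift j d) N ξ))
    (fun j ξ => broadcast_message_pos _ _ _) fun j => sum_broadcast_message _ _]
  rw [levelEntropy, ← Equiv.sum_comp (splitLevel d N (Fin q))]
  refine Finset.sum_congr rfl fun ξ _ => ?_
  congr 1
  funext i
  rw [message_succ]

theorem levelEntropy_le (hq : 2 ≤ q) (hβ : 0 ≤ β) (d : List ℕ → ℕ) (N : ℕ) :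
    levelEntropy β q d (N + 1) ≤ rate β q ^ N *
      ((∑ s : Fin q, symmEntropy (broadcast β (Pi.single s 1))) * levelSize d (N + 1)) := by
  induction N generalizing d with
  | zero =>
    rw [levelEntropy_succ, pow_zero, one_mul, levelSize_succ]
    simp only [message_zero]
    push_cast
    rw [Finset.mul_sum]
    refine Finset.sum_le_sum fun j _ => le_of_eq ?_
    have h1 : levelSize (shift j d) 0 = 1 := Fintype.card_unique
    rw [h1, Nat.cast_one, mul_one]
    exact Equiv.sum_comp (Equiv.funUnique (TreeLevel (shift j d) 0) (Fin q))
      fun s => symmEntropy (broadcast β (Pi.single s 1))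
  | succ N ih =>
    rw [levelEntropy_succ, levelSize_succ]
    push_cast
    rw [Finset.mul_sum, Finset.mul_sum]
    refine Finset.sum_le_sum fun j _ => ?_
    calc _ ≤ ∑ ξ : TreeLevel (shift j d) (N + 1) → Fin q,
          rate β q * symmEntropy (message β (shift j d) (N + 1) ξ) :=
          Finset.sum_le_sum fun ξ _ => symmEntropy_broadcast_le hq hβ (message_succ_pos _ _ _)
      _ = rate β q * levelEntropy β q (shift j d) (N + 1) := (Finset.mul_sum _ _ _).symm
      _ ≤ _ := mul_le_mul_of_nonneg_left (ih _) (rate_nonneg hq hβ)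
      _ = _ := by ring

/-- Twice the total variation distance between the laws of level `N` for two root spins. -/
def levelDist (β : ℝ) (d : List ℕ → ℕ) (N : ℕ) (i k : Fin q) : ℝ :=
  ∑ ξ, |message β d N ξ i - message β d N ξ k|

theorem levelDist_sq_le (d : List ℕ → ℕ) (N : ℕ) (i k : Fin q) :
    levelDist β d (N + 1) i k ^ 2 ≤ 4 * q * levelEntropy β q d (N + 1) := by
  have hp := message_succ_pos (β := β) (q := q) d N
  have h := Finset.sum_sq_le_sum_mul_sum_of_sq_le_mul Finset.univ
    (r := fun ξ => |message β d (N + 1) ξ i - message β d (N + 1) ξ k|)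
    (f := fun ξ => message β d (N + 1) ξ i + message β d (N + 1) ξ k)
    (g := fun ξ => (message β d (N + 1) ξ i - message β d (N + 1) ξ k) ^ 2 /
      (message β d (N + 1) ξ i + message β d (N + 1) ξ k))
    (fun ξ _ => (add_pos (hp ξ i) (hp ξ k)).le)
    (fun ξ _ => div_nonneg (sq_nonneg _) (add_pos (hp ξ i) (hp ξ k)).le)
    (fun ξ _ => by rw [sq_abs, mul_div_cancel₀ _ (add_pos (hp ξ i) (hp ξ k)).ne'])
  rw [Finset.sum_add_distrib, sum_message, sum_message] at h
  refine h.trans ?_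
  calc _ ≤ (1 + 1 : ℝ) * ∑ ξ, 2 * q * symmEntropy (message β d (N + 1) ξ) :=
        mul_le_mul_of_nonneg_left (Finset.sum_le_sum fun ξ _ =>
          sq_sub_div_add_le_symmEntropy (hp ξ) i k) (by norm_num)
    _ = _ := by rw [← Finset.mul_sum, levelEntropy]; ring

/-- The growth condition on the tree under which there is no reconstruction. -/
def SubcriticalGrowth (β : ℝ) (q : ℕ) (d : List ℕ → ℕ) : Prop :=
  Tendsto (fun N => rate β q ^ N * (levelSize d N : ℝ)) atTop (𝓝 0)

omit [NeZero q] in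
theorem SubcriticalGrowth.succ {d : List ℕ → ℕ} (h : SubcriticalGrowth β q d) :
    Tendsto (fun N => rate β q ^ N * (levelSize d (N + 1) : ℝ)) atTop (𝓝 0) := by
  by_cases hr : rate β q = 0
  · refine tendsto_const_nhds.congr' ?_
    filter_upwards [eventually_ge_atTop 1] with N hN
    rw [hr, zero_pow (by omega), zero_mul]
  · have h1 := ((tendsto_add_atTop_iff_nat 1).2 h).const_mul (rate β q)⁻¹
    rw [mul_zero] at h1
    refine h1.congr fun N => ?_
    rw [pow_succ]
    field_simp

omit [NeZero q] in
theorem SubcriticalGrowth.shift (hq : 2 ≤ q) (hβ : 0 ≤ β) {d : List ℕ → ℕ}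
    (h : SubcriticalGrowth β q d) (j : Fin (d [])) : SubcriticalGrowth β q (shift j d) := by
  refine squeeze_zero (fun N => ?_) (fun N => ?_) h.succ
  · exact mul_nonneg (pow_nonneg (rate_nonneg hq hβ) N) (Nat.cast_nonneg _)
  · refine mul_le_mul_of_nonneg_left ?_ (pow_nonneg (rate_nonneg hq hβ) N)
    rw [levelSize_succ]
    exact_mod_cast Finset.single_le_sum (f := fun j : Fin (d []) => levelSize (PottsTree.shift j d) N)
      (fun _ _ => Nat.zero_le _) (Finset.mem_univ j)

theorem levelDist_nonneg (d : List ℕ → ℕ) (N : ℕ) (i k : Fin q) : 0 ≤ levelDist β d N i k :=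
  Finset.sum_nonneg fun _ _ => abs_nonneg _

theorem tendsto_levelDist (hq : 2 ≤ q) (hβ : 0 ≤ β) {d : List ℕ → ℕ}
    (h : SubcriticalGrowth β q d) (i k : Fin q) :
    Tendsto (fun N => levelDist β d N i k) atTop (𝓝 0) := by
  rw [← tendsto_add_atTop_iff_nat 1]
  have h1 := h.succ.const_mul
    (4 * q * ∑ s : Fin q, symmEntropy (broadcast β (Pi.single s 1)))
  rw [mul_zero] at h1
  have h2 : Tendsto (fun N => levelDist β d (N + 1) i k ^ 2) atTop (𝓝 0) := by
    refine squeeze_zero (fun N => sq_nonneg _) (fun N => ?_) h1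
    refine (levelDist_sq_le d N i k).trans ?_
    calc _ ≤ 4 * q * (rate β q ^ N * ((∑ s : Fin q, symmEntropy (broadcast β (Pi.single s 1))) *
          levelSize d (N + 1))) :=
          mul_le_mul_of_nonneg_left (levelEntropy_le hq hβ d N) (by positivity)
      _ = _ := by ring
  have h3 := h2.sqrt
  rw [Real.sqrt_zero] at h3
  exact h3.congr fun N => Real.sqrt_sq (levelDist_nonneg _ _ _ _)

/-! ### Asymptotic independence of the ball and the far levels -/

theorem chainLaw_ballEvent_of_ne (d : List ℕ → ℕ) (n : ℕ) (τ : List ℕ → Fin q) {i : Fin q}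
    (hi : i ≠ τ []) (A : Set (List ℕ → Fin q)) : (chainLaw β i).real (ballEvent d n τ ∩ A) = 0 := by
  rw [Measure.real, measure_eq_zero_iff_ae_notMem.2, ENNReal.toReal_zero]
  filter_upwards [chainLaw_root (β := β) i] with η hη h
  exact hi (hη.symm.trans (h.1 [] trivial (Nat.zero_le _)))

theorem chainLaw_root_inter (i : Fin q) (A : Set (List ℕ → Fin q)) :
    (chainLaw β i).real ({η | η [] = i} ∩ A) = (chainLaw β i).real A := by
  refine measureReal_congr ?_
  filter_upwards [chainLaw_root (β := β) i] with η hη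
  exact propext ⟨fun h => h.2, fun h => ⟨hη, h⟩⟩

theorem chainLaw_ballEvent_succ (d : List ℕ → ℕ) (n : ℕ) (τ : List ℕ → Fin q) :
    (chainLaw β (τ [])).real (ballEvent d (n + 1) τ) = ∏ j : Fin (d []),
      broadcast β (fun s => (chainLaw β s).real (ballEvent (shift j d) n (shift j τ))) (τ []) := by
  rw [ballEvent_succ, chainLaw_root_inter,
    chainLaw_branch _ _ fun j : Fin (d []) => measurableSet_ballEvent (shift j d) n (shift j τ)]

theorem chainLaw_ballEvent_inter_levelEvent_succ (d : List ℕ → ℕ) (n N : ℕ) (τ : List ℕ → Fin q)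
    (ξ : TreeLevel d (N + 1) → Fin q) :
    (chainLaw β (τ [])).real (ballEvent d (n + 1) τ ∩ levelEvent d (N + 1) ξ) =
      ∏ j : Fin (d []), broadcast β (fun s => (chainLaw β s).real
        (ballEvent (shift j d) n (shift j τ) ∩
          levelEvent (shift j d) N (splitLevel d N _ ξ j))) (τ []) := by
  rw [ballEvent_succ, levelEvent_succ, Set.inter_assoc, chainLaw_root_inter,
    ← chainLaw_branch _ _ fun j : Fin (d []) =>
      (measurableSet_ballEvent (shift j d) n (shift j τ)).inter (measurableSet_levelEvent _ _ _)]
  congr 1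
  ext η
  exact forall_and.symm

/-- The dependence between the ball of radius `n` and the level `N`. -/
def ballLevelDist (β : ℝ) (d : List ℕ → ℕ) (n : ℕ) (τ : List ℕ → Fin q) (N : ℕ)
    (i k : Fin q) : ℝ :=
  ∑ ξ, |(chainLaw β i).real (ballEvent d n τ ∩ levelEvent d N ξ) -
    (chainLaw β i).real (ballEvent d n τ) * message β d N ξ k|

theorem ballLevelDist_nonneg (d : List ℕ → ℕ) (n : ℕ) (τ : List ℕ → Fin q) (N : ℕ) (i k : Fin q) :
    0 ≤ ballLevelDist β d n τ N i k := Finset.sum_nonneg fun _ _ => abs_nonneg _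

theorem ballLevelDist_le_add (d : List ℕ → ℕ) (n : ℕ) (τ : List ℕ → Fin q) (N : ℕ)
    (i j k : Fin q) :
    ballLevelDist β d n τ N i k ≤ ballLevelDist β d n τ N i j + levelDist β d N j k := by
  unfold ballLevelDist levelDist
  rw [← Finset.sum_add_distrib]
  refine Finset.sum_le_sum fun ξ _ => ?_
  refine (abs_sub_le _ ((chainLaw β i).real (ballEvent d n τ) * message β d N ξ j) _).trans ?_
  refine add_le_add le_rfl ?_
  rw [← mul_sub, abs_mul, abs_of_nonneg measureReal_nonneg]
  exact mul_le_of_le_one_left (abs_nonneg _) measureReal_le_one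

theorem broadcast_nonneg {f : Fin q → ℝ} (hf : ∀ i, 0 ≤ f i) (i : Fin q) : 0 ≤ broadcast β f i :=
  Finset.sum_nonneg fun s _ => mul_nonneg (transition_pos i s).le (hf s)

theorem broadcast_mono {f g : Fin q → ℝ} (h : ∀ i, f i ≤ g i) (i : Fin q) :
    broadcast β f i ≤ broadcast β g i :=
  Finset.sum_le_sum fun s _ => mul_le_mul_of_nonneg_left (h s) (transition_pos i s).le

theorem ballLevelDist_succ_le (d : List ℕ → ℕ) (n : ℕ) (τ : List ℕ → Fin q) (N : ℕ) :
    ballLevelDist β d (n + 1) τ (N + 1) (τ []) (τ []) ≤ ∑ j : Fin (d []), ∑ s, ∑ t,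
      transition β (τ []) s * transition β (τ []) t *
        ballLevelDist β (shift j d) n (shift j τ) N s t := by
  set i := τ [] with hi
  let P : Fin (d []) → Fin q → ℝ := fun j s =>
    (chainLaw β s).real (ballEvent (shift j d) n (shift j τ))
  let a : ∀ j : Fin (d []), (TreeLevel (shift j d) N → Fin q) → ℝ := fun j ξ =>
    broadcast β (fun s => (chainLaw β s).real (ballEvent (shift j d) n (shift j τ) ∩
      levelEvent (shift j d) N ξ)) i
  let b : ∀ j : Fin (d []), (TreeLevel (shift j d) N → Fin q) → ℝ := fun j ξ =>
    broadcast β (P j) i * broadcast β (message β (shift j d) N ξ) i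
  have hP1 : ∀ j, broadcast β (P j) i ≤ 1 := fun j =>
    (broadcast_mono (fun s => measureReal_le_one) i).trans_eq (broadcast_const 1 i)
  have hP0 : ∀ j, 0 ≤ broadcast β (P j) i := fun j => broadcast_nonneg (fun s => measureReal_nonneg) i
  have ha0 : ∀ j ξ, 0 ≤ a j ξ := fun j ξ => broadcast_nonneg (fun s => measureReal_nonneg) i
  have hb0 : ∀ j ξ, 0 ≤ b j ξ := fun j ξ => mul_nonneg (hP0 j) (broadcast_message_pos _ _ _ _).le
  have ha1 : ∀ j, ∑ ξ, a j ξ ≤ 1 := fun j => by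
    rw [sum_broadcast_comm]
    simp only [sum_real_inter_levelEvent _ _ (measurableSet_ballEvent (shift j d) n (shift j τ))]
    exact hP1 j
  have hb1 : ∀ j, ∑ ξ, b j ξ ≤ 1 := fun j => by
    rw [← Finset.mul_sum, sum_broadcast_message, mul_one]
    exact hP1 j
  have hsum := sum_abs_prod_sub_prod_le a b ha0 hb0 ha1 hb1
  calc ballLevelDist β d (n + 1) τ (N + 1) i i
      = ∑ x : ∀ j : Fin (d []), TreeLevel (shift j d) N → Fin q,
          |∏ j, a j (x j) - ∏ j, b j (x j)| := by
        rw [ballLevelDist, ← Equiv.sum_comp (splitLevel d N (Fin q))]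
        refine Finset.sum_congr rfl fun ξ _ => ?_
        rw [hi, chainLaw_ballEvent_inter_levelEvent_succ, chainLaw_ballEvent_succ, message_succ,
          ← Finset.prod_mul_distrib]
    _ ≤ _ := hsum
    _ ≤ _ := by
        refine Finset.sum_le_sum fun j _ => ?_
        have h : ∀ ξ, a j ξ - b j ξ = ∑ s, ∑ t, transition β i s * transition β i t *
            ((chainLaw β s).real (ballEvent (shift j d) n (shift j τ) ∩
              levelEvent (shift j d) N ξ) - P j s * message β (shift j d) N ξ t) := by
          intro ξ
          simp only [a, b, broadcast, mul_sub, Finset.sum_sub_distrib, Finset.sum_mul_sum]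
          congr 1
          · refine Finset.sum_congr rfl fun s _ => ?_
            rw [← Finset.sum_mul, ← Finset.mul_sum, sum_transition, mul_one]
          · refine Finset.sum_congr rfl fun s _ => Finset.sum_congr rfl fun t _ => ?_
            ring
        calc ∑ ξ, |a j ξ - b j ξ| ≤ ∑ ξ, ∑ s, ∑ t, transition β i s * transition β i t *
            |(chainLaw β s).real (ballEvent (shift j d) n (shift j τ) ∩
              levelEvent (shift j d) N ξ) - P j s * message β (shift j d) N ξ t| := by
              refine Finset.sum_le_sum fun ξ _ => ?_
              rw [h]
              refine (Finset.abs_sum_le_sum_abs _ _).trans (Finset.sum_le_sum fun s _ => ?_)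
              refine (Finset.abs_sum_le_sum_abs _ _).trans (Finset.sum_le_sum fun t _ => ?_)
              rw [abs_mul, abs_of_pos (mul_pos (transition_pos i s) (transition_pos i t))]
          _ = _ := by
              rw [Finset.sum_comm]
              refine Finset.sum_congr rfl fun s _ => ?_
              rw [Finset.sum_comm]
              refine Finset.sum_congr rfl fun t _ => ?_
              rw [← Finset.mul_sum]
              rfl

/-- Without reconstruction the spins in a ball and at level `N` become independent. -/
theorem tendsto_ballLevelDist (hq : 2 ≤ q) (hβ : 0 ≤ β) {d : List ℕ → ℕ}
    (h : SubcriticalGrowth β q d) (n : ℕ) (τ : List ℕ → Fin q) (i k : Fin q) :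
    Tendsto (fun N => ballLevelDist β d n τ N i k) atTop (𝓝 0) := by
  induction n generalizing d τ i k with
  | zero =>
    by_cases hi : i = τ []
    · refine (tendsto_levelDist hq hβ h i k).congr fun N => ?_
      refine Finset.sum_congr rfl fun ξ _ => ?_
      rw [ballEvent_zero, ← hi, chainLaw_root_inter, ← Set.inter_univ
        {η : List ℕ → Fin q | η [] = i}, chainLaw_root_inter, probReal_univ, one_mul]
      rfl
    · refine tendsto_const_nhds.congr fun N => (Finset.sum_eq_zero fun ξ _ => ?_).symm
      have h0 := chainLaw_ballEvent_of_ne (β := β) d 0 τ hi Set.univ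
      rw [Set.inter_univ] at h0
      rw [chainLaw_ballEvent_of_ne d 0 τ hi, h0, zero_mul, sub_zero, abs_zero]
  | succ n ih =>
    by_cases hi : i = τ []
    · subst hi
      rw [← tendsto_add_atTop_iff_nat 1]
      have h1 : Tendsto (fun N => (∑ j : Fin (d []), ∑ s, ∑ t,
          transition β (τ []) s * transition β (τ []) t *
            ballLevelDist β (shift j d) n (shift j τ) N s t) + levelDist β d (N + 1) (τ []) k)
          atTop (𝓝 ((∑ _j : Fin (d []), ∑ s, ∑ t,
            transition β (τ []) s * transition β (τ []) t * 0) + 0)) := by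
        refine Tendsto.add ?_ ((tendsto_add_atTop_iff_nat 1).2 (tendsto_levelDist hq hβ h _ _))
        refine tendsto_finsetSum _ fun j _ => tendsto_finsetSum _ fun s _ =>
          tendsto_finsetSum _ fun t _ => (ih (h.shift hq hβ j) _ s t).const_mul _
      simp only [mul_zero, Finset.sum_const_zero, add_zero] at h1
      refine squeeze_zero (fun N => ballLevelDist_nonneg _ _ _ _ _ _) (fun N => ?_) h1
      exact (ballLevelDist_le_add _ _ _ _ _ (τ []) _).trans
        (add_le_add (ballLevelDist_succ_le d n τ N) le_rfl)
    · refine tendsto_const_nhds.congr fun N => (Finset.sum_eq_zero fun ξ _ => ?_).symm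
      have h0 := chainLaw_ballEvent_of_ne (β := β) d (n + 1) τ hi Set.univ
      rw [Set.inter_univ] at h0
      rw [chainLaw_ballEvent_of_ne d (n + 1) τ hi, h0, zero_mul, sub_zero, abs_zero]

end Messages

/-! ### Measures on configurations with finitely many spin values -/

section Configurations

variable {V : Type*} {q : ℕ}

/-- The configurations that agree with `τ` on `B`. -/
def agreeOn (B : Finset V) (τ : V → Fin q) : Set (V → Fin q) := {η | ∀ v ∈ B, η v = τ v}

theorem measurableSet_agreeOn (B : Finset V) (τ : V → Fin q) : MeasurableSet (agreeOn B τ) :=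
  measurableSet_agree B τ

/-- Finite measures on configurations that agree on the cylinders over arbitrarily large finite
sets are equal. -/
theorem ext_of_agreeOn {μ ν : Measure (V → Fin q)} [IsFiniteMeasure μ] [IsFiniteMeasure ν]
    (h : ∀ I : Finset V, ∃ F : Finset V, I ⊆ F ∧ ∀ ζ, μ (agreeOn F ζ) = ν (agreeOn F ζ)) :
    μ = ν := by
  have hmap : ∀ I : Finset V, μ.map I.restrict = ν.map I.restrict := by
    intro I
    obtain ⟨F, hIF, hF⟩ := h I
    have hFmap : μ.map F.restrict = ν.map F.restrict := by
      refine Measure.ext_of_singleton fun ζ => ?_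
      rw [Measure.map_apply (Finset.measurable_restrict F) (measurableSet_singleton _),
        Measure.map_apply (Finset.measurable_restrict F) (measurableSet_singleton _)]
      rcases Set.eq_empty_or_nonempty (F.restrict ⁻¹' {ζ} : Set (V → Fin q)) with h0 | ⟨η, hη⟩
      · rw [h0, measure_empty, measure_empty]
      · have : (F.restrict ⁻¹' {ζ} : Set (V → Fin q)) = agreeOn F η := by
          ext η'
          rw [Set.mem_preimage, Set.mem_singleton_iff] at hη ⊢
          rw [← hη]
          exact ⟨fun h v hv => congrFun h ⟨v, hv⟩, fun h => funext fun v => h v.1 v.2⟩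
        rw [this]
        exact hF η
    rw [← Finset.restrict₂_comp_restrict hIF, ← Measure.map_map (Finset.measurable_restrict₂ hIF)
      (Finset.measurable_restrict F), hFmap, Measure.map_map (Finset.measurable_restrict₂ hIF)
      (Finset.measurable_restrict F)]
  have : ∀ I : Finset V, IsFiniteMeasure (μ.map I.restrict) := fun I => inferInstance
  exact IsProjectiveLimit.unique (P := fun I => μ.map I.restrict) (fun I => rfl)
    fun I => (hmap I).symm

theorem exists_eq_preimage_of_cylinderEvents {Δ : Set V} {A : Set (V → Fin q)}
    (hA : MeasurableSet[cylinderEvents (X := fun _ : V => Fin q) Δ] A) :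
    ∃ B : Set (Δ → Fin q), MeasurableSet B ∧ (fun (η : V → Fin q) (u : Δ) => η u.1) ⁻¹' B = A := by
  have hle : cylinderEvents (X := fun _ : V => Fin q) Δ ≤
      MeasurableSpace.comap (fun (η : V → Fin q) (u : Δ) => η u.1) MeasurableSpace.pi := by
    refine iSup₂_le fun v hv => ?_
    rw [← measurable_iff_comap_le]
    have hv' : Measurable fun ζ : Δ → Fin q => ζ ⟨v, hv⟩ := measurable_pi_apply _
    exact hv'.comp (comap_measurable _)
  exact hle A hA

theorem glue_of_mem {Λ : Finset V} (σ : Λ → Fin q) (η : V → Fin q) {v : V} (hv : v ∈ Λ) :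
    glue Λ σ η v = σ ⟨v, hv⟩ := dif_pos hv

theorem glue_of_notMem {Λ : Finset V} (σ : Λ → Fin q) (η : V → Fin q) {v : V} (hv : v ∉ Λ) :
    glue Λ σ η v = η v := dif_neg hv

theorem measurable_glue (Λ : Finset V) (σ : Λ → Fin q) :
    Measurable[cylinderEvents (X := fun _ : V => Fin q) ((Λ : Set V)ᶜ)] (glue Λ σ) := by
  refine @measurable_pi_lambda _ _ _ (cylinderEvents _) _ _ fun v => ?_
  by_cases hv : v ∈ Λ
  · simp only [glue_of_mem σ _ hv]
    exact measurable_const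
  · simp only [glue_of_notMem σ _ hv]
    exact measurable_cylinderEvent_apply (by simpa using hv)

theorem edgeAgree_mk (η : V → Fin q) (v w : V) :
    edgeAgree η s(v, w) = if η v = η w then 1 else 0 := by
  classical
  simp only [edgeAgree, Sym2.lift_mk]

theorem edgeAgree_congr {η η' : V → Fin q} {e : Sym2 V} (h : ∀ v ∈ e, η v = η' v) :
    edgeAgree η e = edgeAgree η' e := by
  induction e using Sym2.ind with
  | h v w =>
    rw [edgeAgree_mk, edgeAgree_mk, h v (Sym2.mem_mk_left v w), h w (Sym2.mem_mk_right v w)]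

theorem measurable_edgeAgree (e : Sym2 V) : Measurable fun η : V → Fin q => edgeAgree η e := by
  induction e using Sym2.ind with
  | h v w =>
    simp only [edgeAgree_mk]
    exact Measurable.ite (measurableSet_eq_fun (by fun_prop) (by fun_prop)) measurable_const
      measurable_const

end Configurations

section Specification

variable {V : Type*} (G : SimpleGraph V) [G.LocallyFinite] {q : ℕ} {β : ℝ}

theorem volumeWeight_pos (Λ : Finset V) (η : V → Fin q) : 0 < volumeWeight G β Λ η :=
  Real.exp_pos _

theorem measurable_volumeWeight (Λ : Finset V) :
    Measurable fun η : V → Fin q => volumeWeight G β Λ η := by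
  unfold volumeWeight
  exact Real.measurable_exp.comp ((Finset.measurable_sum _ fun e _ =>
    measurable_edgeAgree e).const_mul _)

theorem measurable_pottsCond (Λ : Finset V) (σ : Λ → Fin q) :
    Measurable[cylinderEvents (X := fun _ : V => Fin q) ((Λ : Set V)ᶜ)]
      fun η : V → Fin q => pottsCond G β Λ σ η := by
  classical
  unfold pottsCond
  have h : ∀ τ : Λ → Fin q, Measurable[cylinderEvents (X := fun _ : V => Fin q) ((Λ : Set V)ᶜ)]
      fun η => volumeWeight G β Λ (glue Λ τ η) := fun τ =>
    (measurable_volumeWeight G Λ).comp (measurable_glue Λ τ)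
  exact (h σ).div (Finset.measurable_sum _ fun τ _ => h τ)

theorem pottsCond_nonneg (Λ : Finset V) (σ : Λ → Fin q) (η : V → Fin q) :
    0 ≤ pottsCond G β Λ σ η :=
  div_nonneg (volumeWeight_pos G _ _).le
    (Finset.sum_nonneg fun _ _ => (volumeWeight_pos G _ _).le)

theorem pottsCond_le_one (Λ : Finset V) (σ : Λ → Fin q) (η : V → Fin q) :
    pottsCond G β Λ σ η ≤ 1 := by
  classical
  refine div_le_one_of_le₀ ?_ (Finset.sum_nonneg fun _ _ => (volumeWeight_pos G _ _).le)
  exact Finset.single_le_sum (f := fun τ => volumeWeight G β Λ (glue Λ τ η))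
    (fun _ _ => (volumeWeight_pos G _ _).le) (Finset.mem_univ σ)

open scoped Classical in
/-- The edges with at least one end point in `Λ`. -/
def incidentEdges (Λ : Finset V) : Finset (Sym2 V) := Λ.biUnion fun v => G.incidenceFinset v

theorem mem_incidentEdges {Λ : Finset V} {e : Sym2 V} :
    e ∈ incidentEdges G Λ ↔ e ∈ G.edgeSet ∧ ∃ v ∈ Λ, v ∈ e := by
  classical
  simp only [incidentEdges, Finset.mem_biUnion, SimpleGraph.mem_incidenceFinset,
    SimpleGraph.incidenceSet, Set.mem_ofPred_eq]
  tauto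

theorem volumeWeight_eq (Λ : Finset V) (η : V → Fin q) :
    volumeWeight G β Λ η = Real.exp (2 * β * ∑ e ∈ incidentEdges G Λ, edgeAgree η e) := rfl

/-- The finite volume probabilities only depend on the spins on the outer boundary. -/
theorem pottsCond_congr {Λ : Finset V} (σ : Λ → Fin q) {η η' : V → Fin q}
    (h : ∀ e ∈ incidentEdges G Λ, ∀ v ∈ e, v ∉ Λ → η v = η' v) :
    pottsCond G β Λ σ η = pottsCond G β Λ σ η' := by
  have hw : ∀ τ : Λ → Fin q, volumeWeight G β Λ (glue Λ τ η) = volumeWeight G β Λ (glue Λ τ η') := by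
    intro τ
    rw [volumeWeight_eq, volumeWeight_eq]
    congr 2
    refine Finset.sum_congr rfl fun e he => edgeAgree_congr fun v hv => ?_
    by_cases hvΛ : v ∈ Λ
    · rw [glue_of_mem τ _ hvΛ, glue_of_mem τ _ hvΛ]
    · rw [glue_of_notMem τ _ hvΛ, glue_of_notMem τ _ hvΛ, h e he v hv hvΛ]
  simp only [pottsCond, hw]

theorem pottsCond_mul_sum {Λ : Finset V} [Fintype (Λ → Fin q)] (η : V → Fin q)
    (f : (Λ → Fin q) → ℝ) (K : ℝ) (h : ∀ τ, f τ = K * volumeWeight G β Λ (glue Λ τ η))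
    (σ : Λ → Fin q) : f σ = pottsCond G β Λ σ η * ∑ τ, f τ := by
  have hpos : 0 < ∑ τ : Λ → Fin q, volumeWeight G β Λ (glue Λ τ η) :=
    Finset.sum_pos (fun τ _ => volumeWeight_pos _ _ _) ⟨σ, Finset.mem_univ _⟩
  have hc : pottsCond G β Λ σ η = volumeWeight G β Λ (glue Λ σ η) /
      ∑ τ : Λ → Fin q, volumeWeight G β Λ (glue Λ τ η) := by
    unfold pottsCond
    congr!
  simp only [h]
  rw [← Finset.mul_sum, hc]
  field_simp

theorem freeWeight_eq {W : Type*} [Fintype W] (H : SimpleGraph W) [Fintype H.edgeSet]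
    (σ : W → Fin q) :
    freeWeight H β σ = Real.exp (2 * β * ∑ e ∈ H.edgeFinset, edgeAgree σ e) := by
  unfold freeWeight
  congr!

theorem freeProb_eq_of_proportional {W : Type*} [Fintype W] (H : SimpleGraph W)
    [Fintype (W → Fin q)] {f : (W → Fin q) → ℝ} {c : ℝ} (h : ∀ σ, f σ = c * freeWeight H β σ)
    (h1 : ∑ σ, f σ = 1) (σ : W → Fin q) : freeProb H β σ = f σ := by
  have hp : freeProb H β σ = freeWeight H β σ / ∑ τ : W → Fin q, freeWeight H β τ := by
    unfold freeProb
    congr!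
  simp only [h, ← Finset.mul_sum] at h1
  rw [hp, h, eq_one_div_of_mul_eq_one_left h1]
  ring

theorem measurableSet_agree_subtype (Λ : Finset V) (σ : Λ → Fin q) :
    MeasurableSet {η : V → Fin q | ∀ v : Λ, η v = σ v} := by
  rw [Set.ofPred_forall]
  exact MeasurableSet.iInter fun v => measurable_pi_apply v.1 (measurableSet_singleton _)

theorem integrable_pottsCond (Λ : Finset V) (σ : Λ → Fin q) (μ : Measure (V → Fin q))
    [IsFiniteMeasure μ] : Integrable (fun η => pottsCond G β Λ σ η) μ :=
  Integrable.of_bound ((measurable_pottsCond G Λ σ).mono cylinderEvents_le_pi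
    le_rfl).aestronglyMeasurable 1 (Eventually.of_forall fun η => by
      rw [Real.norm_of_nonneg (pottsCond_nonneg G Λ σ η)]
      exact pottsCond_le_one G Λ σ η)

variable {G} in
theorem measureReal_inter_of_isPottsGibbs {μ : Measure (V → Fin q)} (h : IsPottsGibbs G β μ)
    (Λ : Finset V) (σ : Λ → Fin q) {A : Set (V → Fin q)}
    (hA : MeasurableSet[cylinderEvents (X := fun _ : V => Fin q) ((Λ : Set V)ᶜ)] A) :
    μ.real (A ∩ {η | ∀ v : Λ, η v = σ v}) = ∫ η in A, pottsCond G β Λ σ η ∂μ := by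
  have := h.isProbabilityMeasure
  rw [← setIntegral_congr_ae (cylinderEvents_le_pi _ hA) ((h.dlr Λ σ).mono fun η hη _ => hη),
    setIntegral_condExp cylinderEvents_le_pi
      ((integrable_const (1 : ℝ)).indicator (measurableSet_agree_subtype Λ σ)) hA,
    setIntegral_indicator (measurableSet_agree_subtype Λ σ)]
  simp

/-- The Potts specification determines the conditional probabilities as soon as it gives the
probabilities of large cylinders. -/
theorem condExp_ae_eq_pottsCond {μ : Measure (V → Fin q)} [IsProbabilityMeasure μ]
    (Λ : Finset V) [DecidablePred (· ∉ Λ)] (σ : Λ → Fin q)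
    (h : ∀ I : Finset V, ∃ F : Finset V, I ⊆ F ∧ ∀ ζ,
      μ.real (agreeOn (F.filter (· ∉ Λ)) ζ ∩ {η | ∀ v : Λ, η v = σ v}) =
          pottsCond G β Λ σ ζ * μ.real (agreeOn (F.filter (· ∉ Λ)) ζ) ∧
        ∀ η ∈ agreeOn (F.filter (· ∉ Λ)) ζ, pottsCond G β Λ σ η = pottsCond G β Λ σ ζ) :
    μ[Set.indicator {η : V → Fin q | ∀ v : Λ, η v = σ v} (fun _ => (1 : ℝ)) |
      cylinderEvents (X := fun _ : V => Fin q) ((Λ : Set V)ᶜ)]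
      =ᵐ[μ] fun η => pottsCond G β Λ σ η := by
  classical
  have hS := measurableSet_agree_subtype Λ σ
  set S : Set (V → Fin q) := {η | ∀ v : Λ, η v = σ v}
  set r : (V → Fin q) → (((Λ : Set V)ᶜ : Set V) → Fin q) := fun η u => η u.1 with hr
  have hrm : Measurable r := measurable_pi_iff.2 fun u => measurable_pi_apply u.1
  have hint := integrable_pottsCond (β := β) G Λ σ μ
  have hfin : IsFiniteMeasure (μ.withDensity fun η => ENNReal.ofReal (pottsCond G β Λ σ η)) :=
    isFiniteMeasure_withDensity_ofReal hint.2
  have hmap : (μ.restrict S).map r =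
      (μ.withDensity fun η => ENNReal.ofReal (pottsCond G β Λ σ η)).map r := by
    refine ext_of_agreeOn fun I => ?_
    obtain ⟨F, hIF, hF⟩ := h (I.map (Function.Embedding.subtype _))
    refine ⟨F.subtype _, fun u hu => Finset.mem_subtype.2
      (hIF (Finset.mem_map_of_mem _ hu)), fun ζ => ?_⟩
    rcases Set.eq_empty_or_nonempty (r ⁻¹' agreeOn (F.subtype _) ζ) with h0 | ⟨ω, hω⟩
    · rw [Measure.map_apply hrm (measurableSet_agreeOn _ _),
        Measure.map_apply hrm (measurableSet_agreeOn _ _), h0, measure_empty, measure_empty]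
    · have hpre : r ⁻¹' agreeOn (F.subtype _) ζ = agreeOn (F.filter (· ∉ Λ)) ω := by
        ext η
        constructor
        · intro hη v hv
          rw [Finset.mem_filter] at hv
          have hv' : v ∈ (Λ : Set V)ᶜ := by simpa using hv.2
          have hm : (⟨v, hv'⟩ : ((Λ : Set V)ᶜ : Set V)) ∈ F.subtype (· ∈ (Λ : Set V)ᶜ) :=
            Finset.mem_subtype.2 hv.1
          exact (hη _ hm).trans (hω _ hm).symm
        · intro hη u hu
          have hu' : u.1 ∈ F.filter (· ∉ Λ) :=
            Finset.mem_filter.2 ⟨Finset.mem_subtype.1 hu, fun h => u.2 (Finset.mem_coe.2 h)⟩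
          exact (hη _ hu').trans (hω _ hu)
      rw [Measure.map_apply hrm (measurableSet_agreeOn _ _),
        Measure.map_apply hrm (measurableSet_agreeOn _ _), hpre,
        Measure.restrict_apply (measurableSet_agreeOn _ _),
        withDensity_apply _ (measurableSet_agreeOn _ _),
        setLIntegral_congr_fun (measurableSet_agreeOn _ _)
          (fun η hη => congrArg ENNReal.ofReal ((hF ω).2 η hη)), setLIntegral_const,
        ← ofReal_measureReal, (hF ω).1, ENNReal.ofReal_mul (pottsCond_nonneg G Λ σ ω),
        ofReal_measureReal]
  refine (ae_eq_condExp_of_forall_setIntegral_eq cylinderEvents_le_pi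
    ((integrable_const (1 : ℝ)).indicator hS) (fun _ _ _ => hint.integrableOn) (fun A hA _ => ?_)
    (measurable_pottsCond G Λ σ).stronglyMeasurable.aestronglyMeasurable).symm
  have hA' : MeasurableSet A := cylinderEvents_le_pi _ hA
  obtain ⟨B, hB, rfl⟩ := exists_eq_preimage_of_cylinderEvents hA
  have h1 := congrArg (fun m : Measure _ => m B) hmap
  beta_reduce at h1
  rw [Measure.map_apply hrm hB, Measure.map_apply hrm hB, Measure.restrict_apply hA',
    withDensity_apply _ hA'] at h1
  rw [setIntegral_indicator hS, integral_eq_lintegral_of_nonneg_ae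
    (Eventually.of_forall fun η => pottsCond_nonneg G Λ σ η) hint.1.restrict, ← h1]
  simp [Measure.real]

end Specification

/-! ### Balls and edges of the tree -/

section Geometry

variable (d : List ℕ → ℕ) {q : ℕ} {β : ℝ}

/-- The ball of radius `N` about the root as a finite set. -/
def ballFinset (N : ℕ) : Finset (TreeVertex d) := (Set.toFinite (treeBall d N)).toFinset

variable {d} in
theorem mem_ballFinset {N : ℕ} {v : TreeVertex d} : v ∈ ballFinset d N ↔ v.1.length ≤ N :=
  Set.Finite.mem_toFinset _

variable {d} in
theorem exists_subset_ballFinset (I : Finset (TreeVertex d)) : ∃ N, I ⊆ ballFinset d N :=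
  ⟨I.sup fun v => v.1.length, fun _ hv => mem_ballFinset.2
    (Finset.le_sup (f := fun v : TreeVertex d => v.1.length) hv)⟩

theorem ballFinset_mono {M N : ℕ} (h : M ≤ N) : ballFinset d M ⊆ ballFinset d N :=
  fun _ hv => mem_ballFinset.2 ((mem_ballFinset.1 hv).trans h)

theorem inTree_tail {v : List ℕ} (h : InTree d v) : InTree d v.tail := by
  cases v with
  | nil => trivial
  | cons k v => exact h.1

variable {d} in
/-- The parent of a vertex; the root is its own parent. -/
def parent (v : TreeVertex d) : TreeVertex d := ⟨v.1.tail, inTree_tail d v.2⟩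

open scoped Classical in
/-- The edges inside the ball of radius `N`. -/
def ballEdges (N : ℕ) : Finset (Sym2 (TreeVertex d)) :=
  ((ballFinset d N).erase (treeRoot d)).image fun v => s(v, parent v)

variable {d} in
theorem exists_cons_parent {v : TreeVertex d} (hv : v ≠ treeRoot d) :
    ∃ k, v.1 = k :: (parent v).1 := by
  obtain ⟨_ | ⟨k, v⟩, h⟩ := v
  · exact absurd rfl hv
  · exact ⟨k, rfl⟩

theorem mem_ballEdges {N : ℕ} {e : Sym2 (TreeVertex d)} :
    e ∈ ballEdges d N ↔ e ∈ (treeGraph d).edgeSet ∧ ∀ v ∈ e, v ∈ ballFinset d N := by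
  classical
  constructor
  · intro he
    obtain ⟨v, hv, rfl⟩ := Finset.mem_image.1 he
    obtain ⟨hne, hv⟩ := Finset.mem_erase.1 hv
    obtain ⟨k, hk⟩ := exists_cons_parent hne
    refine ⟨Or.inr ⟨k, hk⟩, fun w hw => ?_⟩
    rcases Sym2.mem_iff.1 hw with rfl | rfl
    · exact hv
    · rw [mem_ballFinset] at hv ⊢
      rw [hk, List.length_cons] at hv
      omega
  · rintro ⟨he, hb⟩
    induction e using Sym2.ind with
    | h v w =>
      have key : ∀ v w : TreeVertex d, w ∈ ballFinset d N → (∃ k, w.1 = k :: v.1) →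
          s(w, v) ∈ ballEdges d N := by
        rintro v w hw ⟨k, hk⟩
        refine Finset.mem_image.2 ⟨w, Finset.mem_erase.2 ⟨?_, hw⟩, ?_⟩
        · rintro rfl
          simp [treeRoot] at hk
        · have : parent w = v := Subtype.ext (congrArg List.tail hk)
          rw [this]
      rcases he with h | h
      · rw [Sym2.eq_swap]
        exact key v w (hb w (Sym2.mem_mk_right v w)) h
      · exact key w v (hb v (Sym2.mem_mk_left v w)) h

theorem sum_ballEdges (N : ℕ) (f : Sym2 (TreeVertex d) → ℝ) :
    ∑ e ∈ ballEdges d N, f e =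
      ∑ v ∈ (ballFinset d N).erase (treeRoot d), f s(v, parent v) := by
  classical
  refine Finset.sum_image fun v hv w hw h => ?_
  obtain ⟨k, hk⟩ := exists_cons_parent (Finset.ne_of_mem_erase hv)
  obtain ⟨l, hl⟩ := exists_cons_parent (Finset.ne_of_mem_erase hw)
  rcases Sym2.eq_iff.1 h with h | ⟨h1, h2⟩
  · exact h.1
  · have a1 := congrArg List.length hk
    have a2 := congrArg List.length hl
    rw [h2, List.length_cons] at a1
    rw [← h1, List.length_cons] at a2
    omega

theorem sum_edgeFinset_induce (N : ℕ) [Fintype ((treeGraph d).induce (treeBall d N)).edgeSet]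
    (τ : TreeVertex d → Fin q) (σ : treeBall d N → Fin q) (h : ∀ v, τ v.1 = σ v) :
    ∑ e ∈ ((treeGraph d).induce (treeBall d N)).edgeFinset, edgeAgree σ e =
      ∑ e ∈ ballEdges d N, edgeAgree τ e := by
  refine Finset.sum_bij (fun e _ => e.map Subtype.val) ?_ ?_ ?_ ?_
  · intro e he
    rw [SimpleGraph.mem_edgeFinset] at he
    rw [mem_ballEdges]
    induction e using Sym2.ind with
    | h v w =>
      refine ⟨he, fun u hu => ?_⟩
      rw [Sym2.map_mk] at hu
      rcases Sym2.mem_iff.1 hu with rfl | rfl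
      · exact mem_ballFinset.2 v.2
      · exact mem_ballFinset.2 w.2
  · intro e _ e' _ hee
    exact Sym2.map.injective Subtype.val_injective hee
  · intro e he
    rw [mem_ballEdges] at he
    induction e using Sym2.ind with
    | h v w =>
      have hv := mem_ballFinset.1 (he.2 v (Sym2.mem_mk_left v w))
      have hw := mem_ballFinset.1 (he.2 w (Sym2.mem_mk_right v w))
      exact ⟨s(⟨v, hv⟩, ⟨w, hw⟩), SimpleGraph.mem_edgeFinset.2 he.1, rfl⟩
  · intro e _
    induction e using Sym2.ind with
    | h v w =>
      rw [Sym2.map_mk, edgeAgree_mk, edgeAgree_mk, h, h]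

theorem length_le_of_adj {v w : TreeVertex d} (h : (treeGraph d).Adj v w) :
    w.1.length ≤ v.1.length + 1 := by
  rcases h with ⟨k, h⟩ | ⟨k, h⟩
  · exact (congrArg List.length h).le
  · have := congrArg List.length h
    rw [List.length_cons] at this
    omega

theorem incidentEdges_subset_ballEdges {Λ : Finset (TreeVertex d)} {N : ℕ}
    (h : Λ ⊆ ballFinset d N) : incidentEdges (treeGraph d) Λ ⊆ ballEdges d (N + 1) := by
  intro e he
  obtain ⟨hes, v, hv, w, rfl⟩ := (mem_incidentEdges _).1 he
  have hN := mem_ballFinset.1 (h hv)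
  have hadj : (treeGraph d).Adj v w := hes
  refine (mem_ballEdges d).2 ⟨hes, fun u hu => mem_ballFinset.2 ?_⟩
  rcases Sym2.mem_iff.1 hu with rfl | rfl
  · omega
  · have := length_le_of_adj d hadj
    omega

end Geometry

/-! ### Measures with Boltzmann weights on balls -/

section BallWeights

variable {d : List ℕ → ℕ} {q : ℕ} {β : ℝ} {μ : Measure (TreeVertex d → Fin q)}

/-- On each ball, `μ` is proportional to the free boundary condition Boltzmann weight. -/
def HasBallWeights (β : ℝ) (μ : Measure (TreeVertex d → Fin q)) : Prop :=
  ∀ N, ∃ c : ℝ, ∀ τ, μ.real (agreeOn (ballFinset d N) τ) =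
    c * Real.exp (2 * β * ∑ e ∈ ballEdges d N, edgeAgree τ e)

open scoped Classical in
theorem HasBallWeights.isFreePotts [NeZero q] [IsProbabilityMeasure μ]
    (h : HasBallWeights β μ) : IsFreePotts d β μ := by
  refine ⟨inferInstance, fun Δ ζ => ?_⟩
  let ext (N : ℕ) (σ : treeBall d N → Fin q) : TreeVertex d → Fin q := fun v =>
    if hv : v ∈ treeBall d N then σ ⟨v, hv⟩ else 0
  have hext : ∀ N σ (v : treeBall d N), ext N σ v.1 = σ v := fun N σ v => dif_pos v.2
  have hdisj : ∀ N (s : Finset (treeBall d N → Fin q)), Set.PairwiseDisjoint (s : Set _)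
      fun σ => agreeOn (ballFinset d N) (ext N σ) := by
    intro N s σ _ τ _ hne
    refine Set.disjoint_left.2 fun η h1 h2 => hne (funext fun v => ?_)
    rw [← hext N σ v, ← hext N τ v, ← h1 v.1 (mem_ballFinset.2 v.2),
      ← h2 v.1 (mem_ballFinset.2 v.2)]
  have hfree : ∀ N σ, freeProb ((treeGraph d).induce (treeBall d N)) β σ =
      μ.real (agreeOn (ballFinset d N) (ext N σ)) := by
    intro N σ
    obtain ⟨c, hc⟩ := h N
    have hw : ∀ σ, μ.real (agreeOn (ballFinset d N) (ext N σ)) =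
        c * freeWeight ((treeGraph d).induce (treeBall d N)) β σ := by
      intro σ
      rw [hc, freeWeight_eq, sum_edgeFinset_induce d N (ext N σ) σ (hext N σ)]
    have hone : ∑ σ, μ.real (agreeOn (ballFinset d N) (ext N σ)) = 1 := by
      rw [← measureReal_biUnion_finset (hdisj N _) fun σ _ => measurableSet_agreeOn _ _,
        ← probReal_univ (μ := μ)]
      congr 1
      refine Set.eq_univ_of_forall fun η => Set.mem_iUnion₂.2 ⟨fun v => η v.1, Finset.mem_univ _, ?_⟩
      exact fun v hv => (hext N (fun v => η v.1) ⟨v, mem_ballFinset.1 hv⟩).symm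
    exact freeProb_eq_of_proportional _ hw hone σ
  obtain ⟨N₀, hN₀⟩ := exists_subset_ballFinset Δ
  refine tendsto_const_nhds.congr' ?_
  filter_upwards [eventually_ge_atTop N₀] with N hN
  have hΔ := hN₀.trans (ballFinset_mono d hN)
  simp only [hfree]
  rw [← measureReal_biUnion_finset (hdisj N _) fun σ _ => measurableSet_agreeOn _ _]
  congr 1
  ext η
  rw [Set.mem_iUnion₂]
  constructor
  · intro hη
    refine ⟨fun v => η v.1, Finset.mem_filter.2 ⟨Finset.mem_univ _, fun v hv => hη v.1 hv⟩, ?_⟩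
    exact fun v hv => (hext N (fun v => η v.1) ⟨v, mem_ballFinset.1 hv⟩).symm
  · rintro ⟨σ, hσ, hη⟩ v hv
    have hb := hΔ hv
    exact (hη v hb).trans ((hext N σ ⟨v, mem_ballFinset.1 hb⟩).trans
      ((Finset.mem_filter.1 hσ).2 ⟨v, mem_ballFinset.1 hb⟩ hv))

theorem agreeOn_glue {V : Type*} {Λ B : Finset V} [DecidablePred (· ∉ Λ)] (h : Λ ⊆ B)
    (σ : Λ → Fin q) (ζ : V → Fin q) :
    agreeOn (B.filter (· ∉ Λ)) ζ ∩ {η | ∀ v : Λ, η v = σ v} = agreeOn B (glue Λ σ ζ) := by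
  ext η
  constructor
  · rintro ⟨h1, h2⟩ v hv
    by_cases hvΛ : v ∈ Λ
    · rw [glue_of_mem σ ζ hvΛ]
      exact h2 ⟨v, hvΛ⟩
    · rw [glue_of_notMem σ ζ hvΛ]
      exact h1 v (Finset.mem_filter.2 ⟨hv, hvΛ⟩)
  · intro hη
    refine ⟨fun v hv => ?_, fun v => ?_⟩
    · obtain ⟨hv, hvΛ⟩ := Finset.mem_filter.1 hv
      rw [hη v hv, glue_of_notMem σ ζ hvΛ]
    · rw [hη v.1 (h v.2), glue_of_mem σ ζ v.2]

theorem sum_real_inter_agree {V : Type*} (μ : Measure (V → Fin q)) [IsFiniteMeasure μ]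
    (Λ : Finset V) {A : Set (V → Fin q)} (hA : MeasurableSet A) [Fintype (Λ → Fin q)] :
    ∑ σ : Λ → Fin q, μ.real (A ∩ {η | ∀ v : Λ, η v = σ v}) = μ.real A := by
  rw [← measureReal_biUnion_finset]
  · congr 1
    ext η
    rw [Set.mem_iUnion₂]
    exact ⟨fun ⟨_, _, h⟩ => h.1, fun h => ⟨fun v => η v, Finset.mem_univ _, h, fun v => rfl⟩⟩
  · intro σ _ τ _ hne
    refine Set.disjoint_left.2 fun η h h' => hne (funext fun v => ?_)
    exact (h.2 v).symm.trans (h'.2 v)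
  · exact fun σ _ => hA.inter (measurableSet_agree_subtype Λ σ)

theorem HasBallWeights.isPottsGibbs [IsProbabilityMeasure μ] (h : HasBallWeights β μ) :
    IsPottsGibbs (treeGraph d) β μ := by
  classical
  refine ⟨inferInstance, fun Λ σ => condExp_ae_eq_pottsCond _ Λ σ fun I => ?_⟩
  obtain ⟨N, hN⟩ := exists_subset_ballFinset (I ∪ Λ)
  have hI := (Finset.subset_union_left.trans hN).trans (ballFinset_mono d (Nat.le_add_right N 1))
  have hΛ := Finset.subset_union_right.trans hN
  have hΛ' := hΛ.trans (ballFinset_mono d (Nat.le_add_right N 1))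
  have hinc := incidentEdges_subset_ballEdges d hΛ
  set E := incidentEdges (treeGraph d) Λ with hE
  refine ⟨ballFinset d (N + 1), hI, fun ζ => ⟨?_, fun η hη => ?_⟩⟩
  · obtain ⟨c, hc⟩ := h (N + 1)
    set R : ℝ := ∑ e ∈ ballEdges d (N + 1) \ E, edgeAgree ζ e with hR
    have hw : ∀ τ : Λ → Fin q,
        μ.real (agreeOn ((ballFinset d (N + 1)).filter (· ∉ Λ)) ζ ∩ {η | ∀ v : Λ, η v = τ v}) =
          c * Real.exp (2 * β * R) * volumeWeight (treeGraph d) β Λ (glue Λ τ ζ) := by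
      intro τ
      rw [agreeOn_glue hΛ', hc, ← Finset.sum_sdiff hinc]
      have : ∑ e ∈ ballEdges d (N + 1) \ E, edgeAgree (glue Λ τ ζ) e = R := by
        refine Finset.sum_congr rfl fun e he => edgeAgree_congr fun v hv => ?_
        refine glue_of_notMem τ ζ fun hvΛ => ?_
        obtain ⟨he1, he2⟩ := Finset.mem_sdiff.1 he
        exact he2 ((mem_incidentEdges _).2 ⟨((mem_ballEdges d).1 he1).1, v, hvΛ, hv⟩)
      rw [this, mul_add, Real.exp_add, volumeWeight_eq, mul_assoc c]
    rw [← sum_real_inter_agree μ Λ (measurableSet_agreeOn _ ζ)]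
    exact pottsCond_mul_sum _ ζ _ _ hw σ
  · refine pottsCond_congr _ σ fun e he v hv hvΛ => hη v (Finset.mem_filter.2 ⟨?_, hvΛ⟩)
    exact ((mem_ballEdges d).1 (hinc he)).2 v hv

end BallWeights

/-! ### Extremality -/

section Extremality

variable {d : List ℕ → ℕ} {q : ℕ} {β : ℝ}

/-- The configurations on the tree with the spins `ξ` at level `N`. -/
def treeLevelEvent (d : List ℕ → ℕ) (N : ℕ) (ξ : TreeLevel d N → Fin q) :
    Set (TreeVertex d → Fin q) := {η | ∀ v : TreeLevel d N, η v.1 = ξ v}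

theorem measurableSet_treeLevelEvent (N : ℕ) (ξ : TreeLevel d N → Fin q) :
    MeasurableSet (treeLevelEvent d N ξ) := by
  rw [treeLevelEvent, Set.ofPred_forall]
  exact MeasurableSet.iInter fun v => measurable_pi_apply v.1 (measurableSet_singleton _)

theorem measurableSet_cylinderEvents_treeLevelEvent (N : ℕ) (ξ : TreeLevel d (N + 1) → Fin q) :
    MeasurableSet[cylinderEvents (X := fun _ : TreeVertex d => Fin q)
      ((ballFinset d N : Set (TreeVertex d))ᶜ)] (treeLevelEvent d (N + 1) ξ) := by
  rw [treeLevelEvent, Set.ofPred_forall]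
  refine @MeasurableSet.iInter _ _ (cylinderEvents _) _ _ fun v => ?_
  have hv : v.1 ∈ ((ballFinset d N : Set (TreeVertex d))ᶜ) := by
    rw [Set.mem_compl_iff, Finset.mem_coe, mem_ballFinset, v.2]
    omega
  have : Measurable[cylinderEvents (X := fun _ : TreeVertex d => Fin q)
      ((ballFinset d N : Set (TreeVertex d))ᶜ)] fun η : TreeVertex d → Fin q => η v.1 :=
    measurable_cylinderEvent_apply hv
  exact this (measurableSet_singleton (ξ v))

theorem sum_real_inter_treeLevelEvent (μ : Measure (TreeVertex d → Fin q)) [IsFiniteMeasure μ]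
    {A : Set (TreeVertex d → Fin q)} (hA : MeasurableSet A) (N : ℕ) :
    ∑ ξ, μ.real (A ∩ treeLevelEvent d N ξ) = μ.real A := by
  rw [← measureReal_biUnion_finset]
  · congr 1
    ext η
    rw [Set.mem_iUnion₂]
    exact ⟨fun ⟨_, _, h⟩ => h.1, fun h => ⟨fun v => η v.1, Finset.mem_univ _, h, fun v => rfl⟩⟩
  · intro ξ _ ζ _ hne
    refine Set.disjoint_left.2 fun η h h' => hne (funext fun v => ?_)
    exact (h.2 v).symm.trans (h'.2 v)
  · exact fun ξ _ => hA.inter (measurableSet_treeLevelEvent N ξ)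

/-- All Gibbs measures have the same conditional probabilities in a ball given the spins at a
larger level. -/
theorem exists_forall_isPottsGibbs_real_inter [NeZero q] {n N : ℕ} (hn : n ≤ N)
    (τ : TreeVertex d → Fin q) (ξ : TreeLevel d (N + 1) → Fin q) :
    ∃ g : ℝ, ∀ μ : Measure (TreeVertex d → Fin q), IsPottsGibbs (treeGraph d) β μ →
      μ.real (agreeOn (ballFinset d n) τ ∩ treeLevelEvent d (N + 1) ξ) =
        g * μ.real (treeLevelEvent d (N + 1) ξ) := by
  classical
  let Λ := ballFinset d N
  let ω : TreeVertex d → Fin q := fun v => if hv : v.1.length = N + 1 then ξ ⟨v, hv⟩ else 0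
  refine ⟨∑ σ : Λ → Fin q with ∀ v : Λ, v.1 ∈ ballFinset d n → σ v = τ v,
    pottsCond (treeGraph d) β Λ σ ω, fun μ hμ => ?_⟩
  have := hμ.isProbabilityMeasure
  have hσ : ∀ σ : Λ → Fin q, μ.real (treeLevelEvent d (N + 1) ξ ∩ {η | ∀ v : Λ, η v = σ v}) =
      pottsCond (treeGraph d) β Λ σ ω * μ.real (treeLevelEvent d (N + 1) ξ) := by
    intro σ
    rw [measureReal_inter_of_isPottsGibbs hμ Λ σ (measurableSet_cylinderEvents_treeLevelEvent N ξ),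
      setIntegral_congr_fun (g := fun _ => pottsCond (treeGraph d) β Λ σ ω)
        (measurableSet_treeLevelEvent _ ξ), setIntegral_const, smul_eq_mul, mul_comm]
    intro η hη
    refine pottsCond_congr _ σ fun e he v hv hvΛ => ?_
    have h1 := mem_ballFinset.1 (((mem_ballEdges d).1
      (incidentEdges_subset_ballEdges d (Finset.Subset.refl Λ) he)).2 v hv)
    have h2 : ¬ v.1.length ≤ N := fun h => hvΛ (mem_ballFinset.2 h)
    have h3 : v.1.length = N + 1 := by omega
    rw [show ω v = ξ ⟨v, h3⟩ from dif_pos h3]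
    exact hη ⟨v, h3⟩
  rw [Finset.sum_mul, ← sum_real_inter_agree μ Λ
    ((measurableSet_agreeOn _ τ).inter (measurableSet_treeLevelEvent _ ξ)), Finset.sum_filter]
  refine Finset.sum_congr rfl fun σ _ => ?_
  split_ifs with h
  · rw [← hσ]
    congr 1
    ext η
    constructor
    · exact fun hη => ⟨hη.1.2, hη.2⟩
    · refine fun hη => ⟨⟨fun v hv => ?_, hη.1⟩, hη.2⟩
      have hvΛ : v ∈ Λ := ballFinset_mono d hn hv
      exact (hη.2 ⟨v, hvΛ⟩).trans (h ⟨v, hvΛ⟩ hv)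
  · have h0 : agreeOn (ballFinset d n) τ ∩ treeLevelEvent d (N + 1) ξ ∩
        {η | ∀ v : Λ, η v = σ v} = ∅ := by
      refine Set.eq_empty_of_forall_notMem fun η hη => h fun v hv => ?_
      exact (hη.2 v).symm.trans (hη.1.1 v.1 hv)
    rw [h0, measureReal_empty]

/-- A Gibbs measure under which the spins in balls and at far levels become independent is
extremal. -/
theorem isExtremalPottsGibbs_of_tendsto [NeZero q] {μ : Measure (TreeVertex d → Fin q)}
    (hμ : IsPottsGibbs (treeGraph d) β μ)
    (h : ∀ (n : ℕ) (τ : TreeVertex d → Fin q), Tendsto (fun N => ∑ ξ : TreeLevel d N → Fin q,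
      |μ.real (agreeOn (ballFinset d n) τ ∩ treeLevelEvent d N ξ) -
        μ.real (agreeOn (ballFinset d n) τ) * μ.real (treeLevelEvent d N ξ)|) atTop (𝓝 0)) :
    IsExtremalPottsGibbs (treeGraph d) β μ := by
  refine ⟨hμ, fun ν hν ν' _ hconv => ?_⟩
  obtain ⟨a, b, ha, hb, -, hab⟩ := hconv
  have hμ1 := hμ.isProbabilityMeasure
  have hν1 := IsPottsGibbs.isProbabilityMeasure hν
  have hle : ∀ A, ν.real A ≤ (a : ℝ)⁻¹ * μ.real A := by
    intro A
    have h1 : (a : ℝ≥0∞) * ν A ≤ μ A := by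
      rw [← hab]
      exact le_self_add
    have h2 := ENNReal.toReal_mono (measure_ne_top μ A) h1
    rw [ENNReal.toReal_mul] at h2
    rw [← div_eq_inv_mul, le_div_iff₀' (by exact_mod_cast ha)]
    exact h2
  refine ext_of_agreeOn fun I => ?_
  obtain ⟨n, hn⟩ := exists_subset_ballFinset I
  refine ⟨ballFinset d n, hn, fun τ => ?_⟩
  suffices hreal : ν.real (agreeOn (ballFinset d n) τ) = μ.real (agreeOn (ballFinset d n) τ) by
    rw [← ofReal_measureReal, hreal, ofReal_measureReal]
  have hlim := ((tendsto_add_atTop_iff_nat 1).2 (h n τ)).const_mul (a : ℝ)⁻¹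
  rw [mul_zero] at hlim
  have hbound : ∀ᶠ N : ℕ in atTop, |ν.real (agreeOn (ballFinset d n) τ) -
      μ.real (agreeOn (ballFinset d n) τ)| ≤ (a : ℝ)⁻¹ * ∑ ξ : TreeLevel d (N + 1) → Fin q,
      |μ.real (agreeOn (ballFinset d n) τ ∩ treeLevelEvent d (N + 1) ξ) -
        μ.real (agreeOn (ballFinset d n) τ) * μ.real (treeLevelEvent d (N + 1) ξ)| := by
    filter_upwards [eventually_ge_atTop n] with N hN
    set p := μ.real (agreeOn (ballFinset d n) τ)
    have h1 : ν.real (agreeOn (ballFinset d n) τ) - p = ∑ ξ : TreeLevel d (N + 1) → Fin q,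
        (ν.real (agreeOn (ballFinset d n) τ ∩ treeLevelEvent d (N + 1) ξ) -
          p * ν.real (treeLevelEvent d (N + 1) ξ)) := by
      have huniv := sum_real_inter_treeLevelEvent ν MeasurableSet.univ (N + 1)
      simp only [Set.univ_inter, probReal_univ] at huniv
      rw [Finset.sum_sub_distrib, sum_real_inter_treeLevelEvent ν (measurableSet_agreeOn _ _),
        ← Finset.mul_sum, huniv, mul_one]
    rw [h1, Finset.mul_sum]
    refine (Finset.abs_sum_le_sum_abs _ _).trans (Finset.sum_le_sum fun ξ _ => ?_)
    obtain ⟨g, hg⟩ := exists_forall_isPottsGibbs_real_inter (β := β) hN τ ξ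
    rw [hg ν hν, hg μ hμ, ← sub_mul, ← sub_mul, abs_mul, abs_mul,
      abs_of_nonneg (measureReal_nonneg (μ := ν)), abs_of_nonneg (measureReal_nonneg (μ := μ)),
      mul_left_comm]
    exact mul_le_mul_of_nonneg_left (hle _) (abs_nonneg _)
  have := ge_of_tendsto hlim hbound
  exact sub_eq_zero.1 (abs_nonpos_iff.1 this)

end Extremality

/-! ### The free boundary condition measure -/

section FreeMeasure

variable {q : ℕ} [NeZero q] {β : ℝ}

/-- The restriction of a configuration on all words to the tree. -/
def restrictTree (d : List ℕ → ℕ) (η : List ℕ → Fin q) : TreeVertex d → Fin q := fun v => η v.1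

omit [NeZero q] in
theorem measurable_restrictTree (d : List ℕ → ℕ) : Measurable (restrictTree (q := q) d) :=
  measurable_pi_iff.2 fun v => measurable_pi_apply v.1

open scoped Classical in
/-- The extension of a configuration on the tree to all words. -/
def extendTree {d : List ℕ → ℕ} (τ : TreeVertex d → Fin q) : List ℕ → Fin q :=
  fun v => if h : InTree d v then τ ⟨v, h⟩ else 0

theorem extendTree_coe {d : List ℕ → ℕ} (τ : TreeVertex d → Fin q) (v : TreeVertex d) :
    extendTree τ v.1 = τ v := dif_pos v.2

/-- The Potts chain on the tree with equidistributed root spin. -/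
def freeMeasure (β : ℝ) (q : ℕ) [NeZero q] (d : List ℕ → ℕ) : Measure (TreeVertex d → Fin q) :=
  ((q : ℝ≥0∞)⁻¹ • ∑ i : Fin q, chainLaw β i).map (restrictTree d)

theorem freeMeasure_real (d : List ℕ → ℕ) {A : Set (TreeVertex d → Fin q)} (hA : MeasurableSet A) :
    (freeMeasure β q d).real A =
      (q : ℝ)⁻¹ * ∑ i : Fin q, (chainLaw β i).real (restrictTree d ⁻¹' A) := by
  rw [freeMeasure, Measure.real, Measure.map_apply (measurable_restrictTree d) hA,
    Measure.smul_apply, smul_eq_mul, ENNReal.toReal_mul, ENNReal.toReal_inv,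
    ENNReal.toReal_natCast, Measure.finsetSum_apply, ENNReal.toReal_sum fun i _ => measure_ne_top _ _]
  rfl

instance (d : List ℕ → ℕ) : IsProbabilityMeasure (freeMeasure β q d) := by
  have : IsProbabilityMeasure ((q : ℝ≥0∞)⁻¹ • ∑ i : Fin q, chainLaw β i) := by
    constructor
    rw [Measure.smul_apply, Measure.finsetSum_apply]
    simp only [measure_univ, Finset.sum_const, Finset.card_univ, Fintype.card_fin, nsmul_eq_mul,
      mul_one, smul_eq_mul]
    exact ENNReal.inv_mul_cancel (by exact_mod_cast NeZero.ne q) (ENNReal.natCast_ne_top q)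
  exact Measure.isProbabilityMeasure_map (measurable_restrictTree d).aemeasurable

theorem preimage_agreeOn_ballFinset (d : List ℕ → ℕ) (n : ℕ) (τ : TreeVertex d → Fin q) :
    restrictTree d ⁻¹' agreeOn (ballFinset d n) τ = ballEvent d n (extendTree τ) := by
  ext η
  constructor
  · intro h v hv hn
    exact (h ⟨v, hv⟩ (mem_ballFinset.2 hn)).trans (extendTree_coe τ ⟨v, hv⟩).symm
  · intro h v hv
    exact (h v.1 v.2 (mem_ballFinset.1 hv)).trans (extendTree_coe τ v)

omit [NeZero q] in
theorem transition_eq_exp (i s : Fin q) : transition β i s =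
    Real.exp (2 * β * if i = s then 1 else 0) * (Real.exp (2 * β) + q - 1)⁻¹ := by
  rw [transition, div_eq_mul_inv]
  split_ifs <;> simp

omit [NeZero q] in
theorem ballEvent_eq_agree (d : List ℕ → ℕ) (N : ℕ) (τ : List ℕ → Fin q) :
    ballEvent d N τ =
      {η | ∀ v ∈ (ballFinset d N).map (Function.Embedding.subtype _), η v = τ v} := by
  ext η
  constructor
  · intro h v hv
    obtain ⟨w, hw, rfl⟩ := Finset.mem_map.1 hv
    exact h w.1 w.2 (mem_ballFinset.1 hw)
  · intro h v hv hN
    exact h v (Finset.mem_map.2 ⟨⟨v, hv⟩, mem_ballFinset.2 hN, rfl⟩)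

theorem hasBallWeights_freeMeasure (d : List ℕ → ℕ) : HasBallWeights β (freeMeasure β q d) := by
  classical
  intro N
  refine ⟨(q : ℝ)⁻¹ * (Real.exp (2 * β) + q - 1)⁻¹ ^ ((ballFinset d N).erase (treeRoot d)).card,
    fun τ => ?_⟩
  rw [freeMeasure_real d (measurableSet_agreeOn _ τ), preimage_agreeOn_ballFinset,
    ballEvent_eq_agree]
  have hB : ∀ k v, k :: v ∈ (ballFinset d N).map (Function.Embedding.subtype (InTree d)) →
      v ∈ (ballFinset d N).map (Function.Embedding.subtype (InTree d)) := by
    intro k v hv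
    obtain ⟨w, hw, hwv⟩ := Finset.mem_map.1 hv
    have hwv' : w.1 = k :: v := hwv
    have hv' : InTree d (k :: v) := hwv' ▸ w.2
    refine Finset.mem_map.2 ⟨⟨v, hv'.1⟩, mem_ballFinset.2 ?_, rfl⟩
    have := mem_ballFinset.1 hw
    rw [hwv', List.length_cons] at this
    show v.length ≤ N
    omega
  have h0 : [] ∈ (ballFinset d N).map (Function.Embedding.subtype (InTree d)) :=
    Finset.mem_map.2 ⟨treeRoot d, mem_ballFinset.2 (Nat.zero_le _), rfl⟩
  simp only [chainLaw_agree hB h0, Finset.sum_ite_eq', Finset.mem_univ, if_true]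
  have herase : ((ballFinset d N).map (Function.Embedding.subtype (InTree d))).erase [] =
      ((ballFinset d N).erase (treeRoot d)).map (Function.Embedding.subtype (InTree d)) := by
    rw [Finset.map_erase]
    rfl
  rw [herase, Finset.prod_map, mul_assoc, sum_ballEdges, Finset.mul_sum, Real.exp_sum,
    ← Finset.prod_const, ← Finset.prod_mul_distrib]
  congr 1
  refine Finset.prod_congr rfl fun v _ => ?_
  have h1 : extendTree τ (Function.Embedding.subtype (InTree d) v) = τ v := extendTree_coe τ v
  have h2 : extendTree τ (Function.Embedding.subtype (InTree d) v).tail = τ (parent v) :=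
    extendTree_coe τ (parent v)
  rw [h1, h2, transition_eq_exp, edgeAgree_mk, mul_comm]
  simp only [eq_comm]

omit [NeZero q] in
theorem preimage_treeLevelEvent (d : List ℕ → ℕ) (N : ℕ) (ξ : TreeLevel d N → Fin q) :
    restrictTree d ⁻¹' treeLevelEvent d N ξ = levelEvent d N ξ := rfl

theorem freeMeasure_ball_inter (d : List ℕ → ℕ) (n : ℕ) (τ : TreeVertex d → Fin q)
    {A : Set (TreeVertex d → Fin q)} (hA : MeasurableSet A) :
    (freeMeasure β q d).real (agreeOn (ballFinset d n) τ ∩ A) =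
      (q : ℝ)⁻¹ * (chainLaw β (τ (treeRoot d))).real
        (ballEvent d n (extendTree τ) ∩ restrictTree d ⁻¹' A) := by
  rw [freeMeasure_real d ((measurableSet_agreeOn _ τ).inter hA), Set.preimage_inter,
    preimage_agreeOn_ballFinset, Finset.sum_eq_single (τ (treeRoot d))]
  · intro i _ hi
    refine chainLaw_ballEvent_of_ne d n _ ?_ _
    rwa [show extendTree τ [] = τ (treeRoot d) from extendTree_coe τ (treeRoot d)]
  · simp

theorem freeMeasure_root_inter (d : List ℕ → ℕ) (i : Fin q)
    {A : Set (TreeVertex d → Fin q)} (hA : MeasurableSet A) :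
    (freeMeasure β q d).real ({η | η (treeRoot d) = i} ∩ A) =
      (q : ℝ)⁻¹ * (chainLaw β i).real (restrictTree d ⁻¹' A) := by
  have h := freeMeasure_ball_inter (β := β) d 0 (fun _ => i) hA
  have h1 : agreeOn (ballFinset d 0) (fun _ => i) = {η | η (treeRoot d) = i} := by
    ext η
    constructor
    · exact fun h => h _ (mem_ballFinset.2 le_rfl)
    · intro h v hv
      have : v = treeRoot d :=
        Subtype.ext (List.length_eq_zero_iff.1 (Nat.le_zero.1 (mem_ballFinset.1 hv)))
      rw [this]
      exact h
  rw [h1, ballEvent_zero, show extendTree (fun _ : TreeVertex d => i) [] = i from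
    extendTree_coe _ (treeRoot d), chainLaw_root_inter] at h
  exact h

theorem cond_freeMeasure_levelEvent (d : List ℕ → ℕ) (N : ℕ) (i : Fin q)
    (ξ : TreeLevel d N → Fin q) :
    (cond (freeMeasure β q d) {η | η (treeRoot d) = i}).real (treeLevelEvent d N ξ) =
      message β d N ξ i := by
  have hq : (q : ℝ) ≠ 0 := NeZero.ne _
  have hm : MeasurableSet {η : TreeVertex d → Fin q | η (treeRoot d) = i} :=
    measurableSet_eq_fun (by fun_prop) (by fun_prop)
  have h1 := freeMeasure_root_inter (β := β) d i (A := Set.univ) MeasurableSet.univ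
  have h2 := freeMeasure_root_inter (β := β) d i (measurableSet_treeLevelEvent N ξ)
  rw [Set.inter_univ, Set.preimage_univ, probReal_univ, mul_one] at h1
  rw [Measure.real, cond_apply hm, ENNReal.toReal_mul, ENNReal.toReal_inv, ← Measure.real,
    ← Measure.real, h1, h2, inv_inv, mul_inv_cancel_left₀ hq]
  rfl

theorem nonReconstruction_freeMeasure (hq : 2 ≤ q) (hβ : 0 ≤ β) {d : List ℕ → ℕ}
    (h : SubcriticalGrowth β q d) : NonReconstruction d (freeMeasure β q d) := by
  intro i j
  have h1 := (tendsto_levelDist hq hβ h i j).const_mul (1 / 2)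
  rw [mul_zero] at h1
  refine h1.congr fun N => ?_
  unfold levelDist
  congr 1
  refine Finset.sum_congr rfl fun ξ _ => ?_
  rw [← cond_freeMeasure_levelEvent, ← cond_freeMeasure_levelEvent]
  rfl

theorem sum_abs_freeMeasure_le (d : List ℕ → ℕ) (n N : ℕ) (τ : TreeVertex d → Fin q) :
    ∑ ξ : TreeLevel d N → Fin q,
      |(freeMeasure β q d).real (agreeOn (ballFinset d n) τ ∩ treeLevelEvent d N ξ) -
        (freeMeasure β q d).real (agreeOn (ballFinset d n) τ) *
          (freeMeasure β q d).real (treeLevelEvent d N ξ)| ≤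
    ((q : ℝ)⁻¹) ^ 2 * ∑ k : Fin q,
      ballLevelDist β d n (extendTree τ) N (τ (treeRoot d)) k := by
  have hq : (q : ℝ) ≠ 0 := NeZero.ne _
  unfold ballLevelDist
  rw [Finset.sum_comm, Finset.mul_sum]
  refine Finset.sum_le_sum fun ξ _ => ?_
  have h1 := freeMeasure_ball_inter (β := β) d n τ MeasurableSet.univ
  rw [Set.inter_univ, Set.preimage_univ, Set.inter_univ] at h1
  rw [freeMeasure_ball_inter d n τ (measurableSet_treeLevelEvent N ξ), h1,
    freeMeasure_real d (measurableSet_treeLevelEvent N ξ), preimage_treeLevelEvent]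
  have h2 : ∀ a b : ℝ, (q : ℝ)⁻¹ * a - (q : ℝ)⁻¹ * b *
      ((q : ℝ)⁻¹ * ∑ k : Fin q, (chainLaw β k).real (levelEvent d N ξ)) =
      ((q : ℝ)⁻¹) ^ 2 * ∑ k : Fin q, (a - b * message β d N ξ k) := by
    intro a b
    rw [Finset.sum_sub_distrib, ← Finset.mul_sum]
    simp only [Finset.sum_const, Finset.card_univ, Fintype.card_fin, nsmul_eq_mul, message]
    field_simp
  rw [h2, abs_mul, abs_of_nonneg (sq_nonneg _)]
  exact mul_le_mul_of_nonneg_left (Finset.abs_sum_le_sum_abs _ _) (sq_nonneg _)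

theorem isExtremalPottsGibbs_freeMeasure (hq : 2 ≤ q) (hβ : 0 ≤ β) {d : List ℕ → ℕ}
    (h : SubcriticalGrowth β q d) :
    IsExtremalPottsGibbs (treeGraph d) β (freeMeasure β q d) := by
  refine isExtremalPottsGibbs_of_tendsto (hasBallWeights_freeMeasure d).isPottsGibbs
    fun n τ => ?_
  have h1 : Tendsto (fun N => ((q : ℝ)⁻¹) ^ 2 * ∑ k : Fin q,
      ballLevelDist β d n (extendTree τ) N (τ (treeRoot d)) k) atTop
      (𝓝 (((q : ℝ)⁻¹) ^ 2 * ∑ _k : Fin q, (0 : ℝ))) :=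
    (tendsto_finsetSum _ fun k _ => tendsto_ballLevelDist hq hβ h n _ _ k).const_mul _
  rw [Finset.sum_const_zero, mul_zero] at h1
  exact squeeze_zero (fun N => Finset.sum_nonneg fun _ _ => abs_nonneg _)
    (fun N => sum_abs_freeMeasure_le d n N τ) h1

end FreeMeasure

/-! ### Growth of the random tree -/

section Growth

theorem sum_treeLevel (d : List ℕ → ℕ) (N : ℕ) (f : List ℕ → ℝ≥0∞) :
    ∑ v : TreeLevel d N, f v.1.1 =
      ∑' v : List ℕ, {v | InTree d v ∧ v.length = N}.indicator f v := by
  have hinj : Function.Injective fun v : TreeLevel d N => v.1.1 := fun v w h =>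
    Subtype.ext (Subtype.ext h)
  have hsupp : Function.support ({v | InTree d v ∧ v.length = N}.indicator f) ⊆
      Set.range fun v : TreeLevel d N => v.1.1 := by
    intro v hv
    have := Set.mem_of_indicator_ne_zero hv
    exact ⟨⟨⟨v, this.1⟩, this.2⟩, rfl⟩
  rw [← hinj.tsum_eq hsupp, tsum_fintype]
  refine Finset.sum_congr rfl fun v _ => ?_
  exact (Set.indicator_of_mem (show v.1.1 ∈ {v | InTree d v ∧ v.length = N} from
    ⟨v.1.2, v.2⟩) f).symm

theorem levelSize_succ_eq_sum (d : List ℕ → ℕ) (N : ℕ) :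
    levelSize d (N + 1) = ∑ v : TreeLevel d N, d v.1.1 := by
  have e : (Σ v : TreeLevel d N, Fin (d v.1.1)) ≃ TreeLevel d (N + 1) :=
    Equiv.ofBijective
      (fun p => ⟨⟨p.2.1 :: p.1.1.1, p.1.1.2, p.2.2⟩, by simp [p.1.2]⟩) <| by
      constructor
      · rintro ⟨⟨⟨v, hv⟩, hv'⟩, ⟨j, hj⟩⟩ ⟨⟨⟨w, hw⟩, hw'⟩, ⟨k, hk⟩⟩ h
        have h1 : j :: v = k :: w := congrArg (fun x : TreeLevel d (N + 1) => x.1.1) h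
        obtain ⟨rfl, rfl⟩ := List.cons_eq_cons.1 h1
        rfl
      · rintro ⟨⟨_ | ⟨k, v⟩, hv⟩, hN⟩
        · simp at hN
        · exact ⟨⟨⟨⟨v, hv.1⟩, by simpa using hN⟩, ⟨k, hv.2⟩⟩, rfl⟩
  rw [levelSize, ← Fintype.card_congr e, Fintype.card_sigma]
  simp

theorem measurableSet_inTree (v : List ℕ) :
    MeasurableSet[cylinderEvents (X := fun _ : List ℕ => ℕ) {u | u.length < v.length}]
      {d | InTree d v} := by
  induction v with
  | nil => exact @MeasurableSet.univ _ (cylinderEvents _)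
  | cons k v ih =>
    have hsub : {u : List ℕ | u.length < v.length} ⊆ {u | u.length < (k :: v).length} :=
      fun u hu => lt_trans (Set.mem_ofPred_eq ▸ hu) (by simp)
    have h1 : MeasurableSet[cylinderEvents (X := fun _ : List ℕ => ℕ)
        {u | u.length < (k :: v).length}] {d | InTree d v} := cylinderEvents_mono hsub _ ih
    have h2 : Measurable[cylinderEvents (X := fun _ : List ℕ => ℕ)
        {u | u.length < (k :: v).length}] fun d : List ℕ → ℕ => d v :=
      measurable_cylinderEvent_apply (show v.length < (k :: v).length by simp)
    exact @MeasurableSet.inter _ (cylinderEvents _) _ _ h1 (h2 (measurableSet_Ioi (a := k)))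

variable (Q : Measure ℕ) [IsProbabilityMeasure Q]

theorem lintegral_indicator_inTree_mul (v : List ℕ) :
    ∫⁻ d, {d | InTree d v}.indicator 1 d * (d v : ℝ≥0∞) ∂(Measure.infinitePi fun _ : List ℕ => Q) =
      (∫⁻ d, {d | InTree d v}.indicator 1 d ∂(Measure.infinitePi fun _ : List ℕ => Q)) *
        ∫⁻ n, (n : ℝ≥0∞) ∂Q := by
  have hdisj : Disjoint {u : List ℕ | u.length < v.length} {v} :=
    Set.disjoint_singleton_right.2 fun h => lt_irrefl v.length h
  have hm : Measurable fun n : ℕ => (n : ℝ≥0∞) := measurable_from_top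
  have h2 : Measurable[cylinderEvents (X := fun _ : List ℕ => ℕ) {v}]
      fun d : List ℕ → ℕ => (d v : ℝ≥0∞) :=
    hm.comp (measurable_cylinderEvent_apply (Set.mem_singleton v))
  have h1 : Measurable[cylinderEvents (X := fun _ : List ℕ => ℕ) {u | u.length < v.length}]
      ({d | InTree d v}.indicator (1 : (List ℕ → ℕ) → ℝ≥0∞)) :=
    (measurable_const (a := (1 : ℝ≥0∞))).indicator (measurableSet_inTree v)
  rw [lintegral_mul_eq_lintegral_mul_lintegral_of_independent_measurableSpace cylinderEvents_le_pi
    cylinderEvents_le_pi (indep_cylinderEvents (fun _ : List ℕ => Q) hdisj) h1 h2]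
  congr 1
  exact (measurePreserving_eval_infinitePi (fun _ : List ℕ => Q) v).lintegral_comp hm

theorem measurable_indicator_inTree (v : List ℕ) :
    Measurable ({d | InTree d v}.indicator (1 : (List ℕ → ℕ) → ℝ≥0∞)) :=
  measurable_one.indicator (cylinderEvents_le_pi _ (measurableSet_inTree v))

theorem natCast_levelSize_eq_tsum (d : List ℕ → ℕ) (N : ℕ) :
    (levelSize d N : ℝ≥0∞) = ∑' v : List ℕ, {v : List ℕ | v.length = N}.indicator
      (fun v => {d | InTree d v}.indicator (1 : (List ℕ → ℕ) → ℝ≥0∞) d) v := by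
  have h := sum_treeLevel d N fun _ => 1
  rw [Finset.sum_const, nsmul_eq_mul, mul_one] at h
  refine h.trans (tsum_congr fun v => ?_)
  classical
  simp only [Set.indicator_apply, Set.mem_ofPred_eq, Pi.one_apply]
  split_ifs <;> first | rfl | tauto

theorem natCast_levelSize_succ_eq_tsum (d : List ℕ → ℕ) (N : ℕ) :
    (levelSize d (N + 1) : ℝ≥0∞) = ∑' v : List ℕ, {v : List ℕ | v.length = N}.indicator
      (fun v => {d | InTree d v}.indicator (1 : (List ℕ → ℕ) → ℝ≥0∞) d * d v) v := by
  rw [levelSize_succ_eq_sum, Nat.cast_sum, sum_treeLevel d N fun v => (d v : ℝ≥0∞)]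
  refine tsum_congr fun v => ?_
  classical
  simp only [Set.indicator_apply, Set.mem_ofPred_eq, Pi.one_apply]
  split_ifs <;> simp_all

theorem measurable_levelSize (N : ℕ) : Measurable fun d : List ℕ → ℕ => (levelSize d N : ℝ≥0∞) := by
  classical
  simp only [natCast_levelSize_eq_tsum]
  refine Measurable.tsum fun v => ?_
  by_cases hv : v.length = N
  · have hv' : v ∈ {v : List ℕ | v.length = N} := hv
    simpa only [Set.indicator_of_mem hv'] using measurable_indicator_inTree v
  · simp [hv]

/-- The mean size of the generations of a Galton–Watson tree. -/
theorem lintegral_levelSize (N : ℕ) :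
    ∫⁻ d, (levelSize d N : ℝ≥0∞) ∂(Measure.infinitePi fun _ : List ℕ => Q) =
      (∫⁻ n, (n : ℝ≥0∞) ∂Q) ^ N := by
  have hcast : ∀ v : List ℕ, Measurable fun d : List ℕ → ℕ => (d v : ℝ≥0∞) := fun v =>
    (measurable_from_top (f := fun n : ℕ => (n : ℝ≥0∞))).comp (measurable_pi_apply v)
  induction N with
  | zero =>
    have : ∀ d : List ℕ → ℕ, levelSize d 0 = 1 := fun d => Fintype.card_unique
    simp [this]
  | succ N ih =>
    have hswap : ∀ g : List ℕ → (List ℕ → ℕ) → ℝ≥0∞, (∀ v, Measurable (g v)) →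
        ∫⁻ d, ∑' v : List ℕ, {v : List ℕ | v.length = N}.indicator (fun v => g v d) v
          ∂(Measure.infinitePi fun _ : List ℕ => Q) =
        ∑' v : List ℕ, {v : List ℕ | v.length = N}.indicator
          (fun v => ∫⁻ d, g v d ∂(Measure.infinitePi fun _ : List ℕ => Q)) v := by
      classical
      intro g hg
      rw [lintegral_tsum]
      · refine tsum_congr fun v => ?_
        by_cases hv : v.length = N <;> simp [hv]
      · intro v
        by_cases hv : v.length = N
        · simpa [hv] using (hg v).aemeasurable
        · simp [hv]
    simp only [natCast_levelSize_eq_tsum] at ih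
    rw [hswap _ measurable_indicator_inTree] at ih
    simp only [natCast_levelSize_succ_eq_tsum]
    rw [hswap (fun v d => {d | InTree d v}.indicator 1 d * (d v : ℝ≥0∞)) fun v =>
      (measurable_indicator_inTree v).mul (hcast v), pow_succ, ← ih, ← ENNReal.tsum_mul_right]
    refine tsum_congr fun v => ?_
    simp only [lintegral_indicator_inTree_mul]
    exact Set.indicator_mul_const _ _ _ _

/-- Almost every tree is small enough for the entropy bound to be effective. -/
theorem ae_subcriticalGrowth {q : ℕ} (hq : 2 ≤ q) {β : ℝ} (hβ : 0 ≤ β)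
    (h : (∫⁻ n, (n : ℝ≥0∞) ∂Q) * ENNReal.ofReal (rate β q) < 1) :
    ∀ᵐ d ∂(Measure.infinitePi fun _ : List ℕ => Q), SubcriticalGrowth β q d := by
  have hint : ∫⁻ d, ∑' N, ENNReal.ofReal (rate β q) ^ N * (levelSize d N : ℝ≥0∞)
      ∂(Measure.infinitePi fun _ : List ℕ => Q) ≠ ∞ := by
    rw [lintegral_tsum fun N => ((measurable_levelSize N).const_mul _).aemeasurable]
    simp only [lintegral_const_mul _ (measurable_levelSize _), lintegral_levelSize, ← mul_pow]
    rw [mul_comm, ENNReal.tsum_geometric]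
    exact ENNReal.inv_ne_top.2 (tsub_pos_of_lt h).ne'
  have hfin := ae_lt_top (Measurable.tsum fun N => (measurable_levelSize N).const_mul _) hint
  filter_upwards [hfin] with d hd
  have h0 := ENNReal.tendsto_atTop_zero_of_tsum_ne_top hd.ne
  have h1 := (ENNReal.tendsto_toReal ENNReal.zero_ne_top).comp h0
  rw [ENNReal.toReal_zero] at h1
  refine h1.congr fun N => ?_
  simp only [Function.comp_apply, ENNReal.toReal_mul, ENNReal.toReal_pow, ENNReal.toReal_natCast,
    ENNReal.toReal_ofReal (rate_nonneg hq hβ)]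

end Growth

end PottsTree

end

theorem theorem1p1 (q : ℕ) (hq : 2 ≤ q) (β : ℝ) (hβ : 0 ≤ β)
    (Q : Measure ℕ) [IsProbabilityMeasure Q]
    (hQ : (∫⁻ n, (n : ℝ≥0∞) ∂Q) *
      ENNReal.ofReal (2 * Real.tanh β / (q - (q - 2) * Real.tanh β) * cBar β q) < 1) :
    ∀ᵐ d ∂(Measure.infinitePi fun _ : List ℕ => Q),
      ∃ μ : Measure (TreeVertex d → Fin q),
        IsFreePotts d β μ ∧ IsExtremalPottsGibbs (treeGraph d) β μ ∧ NonReconstruction d μ := by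
  have : NeZero q := ⟨by omega⟩
  filter_upwards [PottsTree.ae_subcriticalGrowth Q hq hβ hQ] with d hd
  exact ⟨PottsTree.freeMeasure β q d, (PottsTree.hasBallWeights_freeMeasure d).isFreePotts,
    PottsTree.isExtremalPottsGibbs_freeMeasure hq hβ hd,
    PottsTree.nonReconstruction_freeMeasure hq hβ hd⟩
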